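/- Let $X$ be a smooth projective toric variety over an algebraically closed field $k$, with Cox ring $S$ (graded by $\operatorname{Pic}(X)$) and irrelevant ideal $B$. Let $M$ be a finitely generated $\operatorname{Pic}(X)$-graded $S$-module with associated coherent sheaf $\widetilde M$ on $X$. A virtual resolution of $M$ is a complex $F_\bullet=[F_0\leftarrow F_1\leftarrow\cdots]$ of finitely generated $\operatorname{Pic}(X)$-graded free $S$-modules such that $\widetilde F_\bullet$ is a locally free resolution of $\widetilde M$; $\operatorname{vdim} M$ is the minimal length of a virtual resolution of $M$; and $\operatorname{codim} M$ is the codimension of $\operatorname{Spec}(S/\operatorname{Ann}_S M)$ in $\operatorname{Spec} S$. The module $M$ is - arithmetically Cohen–Macaulay if it is a Cohen–Macaulay $S$-module; - virtually Cohen–Macaulay if $\widetilde M\neq 0$ and $\operatorname{vdim} M=\operatorname{codim} M$; - geometrically Cohen–Macaulay if $M_P$ is a Cohen–Macaulay $S_P$-module for every prime $P$ in the support of $M$ that is relevant, i.e. $B^t\not\subseteq P$ for all $t\ge 1$. Then: 1. if $M$ is arithmetically Cohen–Macaulay and $\widetilde M\neq 0$, then $M$ is virtually Cohen–Macaulay;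 2. if $M$ is virtually Cohen–Macaulay, then $M$ is geometrically Cohen–Macaulay. -/

import Mathlib

/-! ### Depth and Cohen–Macaulay modules -/

/-- The depth of a module `N` over a local ring `A`: the supremum of the lengths of the
`N`-regular sequences contained in the maximal ideal. -/
noncomputable def localDepth (A : Type*) [CommRing A] [IsLocalRing A]
    (N : Type*) [AddCommGroup N] [Module A N] : ℕ∞ :=
  ⨆ (rs : List A) (_ : (∀ r ∈ rs, r ∈ IsLocalRing.maximalIdeal A) ∧
    RingTheory.Sequence.IsRegular N rs), (rs.length : ℕ∞)

/-- A (finitely generated) module over a (Noetherian) local ring is Cohen–Macaulay if it is zero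
or its depth equals its Krull dimension (the dimension of its support). -/
def IsLocalCohenMacaulay (A : Type*) [CommRing A] [IsLocalRing A]
    (N : Type*) [AddCommGroup N] [Module A N] : Prop :=
  Subsingleton N ∨ (localDepth A N : WithBot ℕ∞) = Module.supportDim A N

/-- The localization `N_P` is a Cohen–Macaulay `A_P`-module. -/
def IsCohenMacaulayAt (A : Type*) [CommRing A] (N : Type*) [AddCommGroup N] [Module A N]
    (P : PrimeSpectrum A) : Prop :=
  IsLocalCohenMacaulay (Localization.AtPrime P.asIdeal)
    (LocalizedModule P.asIdeal.primeCompl N)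

/-- A module over a (Noetherian) ring is Cohen–Macaulay if all its localizations at primes in its
support are. -/
def IsCohenMacaulayModule (A : Type*) [CommRing A] (N : Type*) [AddCommGroup N] [Module A N] :
    Prop :=
  ∀ P ∈ Module.support A N, IsCohenMacaulayAt A N P

/-! ### Smooth projective toric varieties -/

/-- The cone in `ℝ^d` spanned by the lattice vectors `v ρ`, `ρ ∈ σ`. -/
def realCone {d : ℕ} {R : Type*} (v : R → Fin d → ℤ) (σ : Finset R) : Set (Fin d → ℝ) :=
  {u | ∃ c : R → ℝ, (∀ ρ, 0 ≤ c ρ) ∧ u = ∑ ρ ∈ σ, c ρ • (fun i => (v ρ i : ℝ))}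

/-- A `d`-dimensional smooth projective toric variety, given by its fan in the lattice `ℤ^d`.
The finite type `R` indexes the rays; as the cones of a smooth fan are simplicial, each is
recorded by the set of its rays. -/
structure SmoothProjectiveFan (d : ℕ) (R : Type*) [Fintype R] [DecidableEq R] where
  /-- the primitive generator of each ray -/
  ray : R → Fin d → ℤ
  /-- the cones of the fan -/
  cones : Set (Finset R)
  /-- every ray is a cone of the fan -/
  ray_mem : ∀ ρ, {ρ} ∈ cones
  /-- a face of a cone is a cone -/
  face_mem : ∀ σ ∈ cones, ∀ τ ⊆ σ, τ ∈ cones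
  /-- two cones meet in their common face -/
  inter : ∀ σ ∈ cones, ∀ τ ∈ cones,
    realCone ray σ ∩ realCone ray τ = realCone ray (σ ∩ τ)
  /-- smoothness: the generators of each cone are part of a `ℤ`-basis of the lattice -/
  smooth : ∀ σ ∈ cones, ∃ (b : Module.Basis (Fin d) ℤ (Fin d → ℤ)) (j : σ ↪ Fin d),
    ∀ ρ : σ, b (j ρ) = ray ρ
  /-- completeness: the cones cover `ℝ^d` -/
  complete : ∀ u : Fin d → ℝ, ∃ σ ∈ cones, u ∈ realCone ray σ
  /-- projectivity: some torus-invariant divisor `∑ a_ρ D_ρ` is ample, i.e. its support function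
  is strictly convex -/
  projective : ∃ a : R → ℤ, ∀ σ ∈ cones, σ.card = d → ∃ m : Fin d → ℤ,
    (∀ ρ ∈ σ, ∑ i, m i * ray ρ i = -a ρ) ∧ (∀ ρ ∉ σ, -a ρ < ∑ i, m i * ray ρ i)

namespace SmoothProjectiveFan

variable {d : ℕ} {R : Type*} [Fintype R] [DecidableEq R] (X : SmoothProjectiveFan d R)

/-- The map sending a character `m` to the principal divisor `∑ ⟨m, v_ρ⟩ D_ρ` of `χ^m`. -/
def divHom : (Fin d → ℤ) →+ (R → ℤ) where
  toFun m := fun ρ => ∑ i, m i * X.ray ρ i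
  map_zero' := by ext; simp
  map_add' m m' := by ext; simp [add_mul, Finset.sum_add_distrib]

/-- `Pic(X)`: torus-invariant divisors modulo the divisors of characters. (`X` being smooth, this
divisor class group is the Picard group.) -/
def Pic : Type _ := (R → ℤ) ⧸ X.divHom.range

noncomputable instance : AddCommGroup X.Pic :=
  inferInstanceAs (AddCommGroup ((R → ℤ) ⧸ X.divHom.range))

noncomputable instance : DecidableEq X.Pic := Classical.decEq _

/-- The class in `Pic(X)` of the prime divisor `D_ρ`. -/
def divClass (ρ : R) : X.Pic := QuotientAddGroup.mk' X.divHom.range (Pi.single ρ 1)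

/-- The Cox ring `S = k[x_ρ]` of `X`. -/
abbrev Cox (_ : SmoothProjectiveFan d R) (k : Type*) [Field k] : Type _ := MvPolynomial R k

variable (k : Type*) [Field k]

/-- The `Pic(X)`-grading of the Cox ring, in which `x_ρ` has degree `[D_ρ]`. -/
noncomputable def coxGrading (α : X.Pic) : Submodule k (X.Cox k) :=
  MvPolynomial.weightedHomogeneousSubmodule k X.divClass α

instance : SetLike.GradedMonoid (X.coxGrading k) :=
  MvPolynomial.WeightedHomogeneousSubmodule.gradedMonoid

/-- The monomial `∏ x_ρ` over the rays `ρ` not in `σ`. -/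
noncomputable def coneMonomial (σ : Finset R) : X.Cox k := ∏ ρ ∈ σᶜ, MvPolynomial.X ρ

/-- The degree of `coneMonomial σ`. -/
noncomputable def coneDeg (σ : Finset R) : X.Pic := ∑ ρ ∈ σᶜ, X.divClass ρ

/-- The irrelevant ideal `B`. -/
noncomputable def irrelevantIdeal : Ideal (X.Cox k) :=
  Ideal.span {f | ∃ σ ∈ X.cones, f = X.coneMonomial k σ}

lemma prod_X_mem (s : Finset R) :
    (∏ ρ ∈ s, MvPolynomial.X ρ : X.Cox k) ∈ X.coxGrading k (∑ ρ ∈ s, X.divClass ρ) :=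
  SetLike.prod_mem_graded _ _ _
    (fun ρ _ => MvPolynomial.isWeightedHomogeneous_X k X.divClass ρ)

lemma coneMonomial_pow_mem (σ : Finset R) (n : ℕ) :
    X.coneMonomial k σ ^ n ∈ X.coxGrading k (n • X.coneDeg σ) :=
  SetLike.pow_mem_graded n (X.prod_X_mem k σᶜ)

lemma coneMonomial_mul {σ τ : Finset R} (h : τ ⊆ σ) :
    X.coneMonomial k τ = (∏ ρ ∈ σ \ τ, MvPolynomial.X ρ) * X.coneMonomial k σ := by
  rw [coneMonomial, coneMonomial, ← Finset.prod_union]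
  · congr 1
    ext ρ
    have := @h ρ
    simp only [Finset.mem_compl, Finset.mem_union, Finset.mem_sdiff]
    tauto
  · rw [Finset.disjoint_left]
    intro ρ
    simp only [Finset.mem_compl, Finset.mem_sdiff]
    tauto

lemma coneDeg_add {σ τ : Finset R} (h : τ ⊆ σ) :
    X.coneDeg τ = (∑ ρ ∈ σ \ τ, X.divClass ρ) + X.coneDeg σ := by
  rw [coneDeg, coneDeg, ← Finset.sum_union]
  · congr 1
    ext ρ
    have := @h ρ
    simp only [Finset.mem_compl, Finset.mem_union, Finset.mem_sdiff]
    tauto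
  · rw [Finset.disjoint_left]
    intro ρ
    simp only [Finset.mem_compl, Finset.mem_sdiff]
    tauto

/-- The multiplicative set of powers of `coneMonomial σ`. -/
noncomputable abbrev coneSub (σ : Finset R) : Submonoid (X.Cox k) := Submonoid.powers (X.coneMonomial k σ)

/-- The element `(coneMonomial σ)^n` of `coneSub σ`. -/
noncomputable def conePow (σ : Finset R) (n : ℕ) : X.coneSub k σ := ⟨X.coneMonomial k σ ^ n, n, rfl⟩

/-- The coordinate ring of the affine chart `U_σ` of `X`: the degree zero part of the
localization of `S` at `coneMonomial σ`. -/
noncomputable def chartRing (σ : Finset R) : Subring (Localization (X.coneSub k σ)) where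
  carrier := {z | ∃ n : ℕ, ∃ a ∈ X.coxGrading k (n • X.coneDeg σ),
    z = Localization.mk a (X.conePow k σ n)}
  zero_mem' := ⟨0, 0, Submodule.zero_mem _, (Localization.mk_zero _).symm⟩
  one_mem' := ⟨0, 1, by simpa using SetLike.one_mem_graded (X.coxGrading k), by
    rw [← Localization.mk_one]; congr 1⟩
  add_mem' := by
    rintro _ _ ⟨n, a, ha, rfl⟩ ⟨m, b, hb, rfl⟩
    refine ⟨n + m, X.coneMonomial k σ ^ n * b + X.coneMonomial k σ ^ m * a,
      Submodule.add_mem _ ?_ ?_, ?_⟩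
    · rw [add_smul]
      exact SetLike.mul_mem_graded (X.coneMonomial_pow_mem k σ n) hb
    · rw [add_comm, add_smul]
      exact SetLike.mul_mem_graded (X.coneMonomial_pow_mem k σ m) ha
    · rw [Localization.add_mk]
      congr 1
      ext
      simp [conePow, pow_add]
  neg_mem' := by
    rintro _ ⟨n, a, ha, rfl⟩
    exact ⟨n, -a, Submodule.neg_mem _ ha, Localization.neg_mk _ _⟩
  mul_mem' := by
    rintro _ _ ⟨n, a, ha, rfl⟩ ⟨m, b, hb, rfl⟩
    refine ⟨n + m, a * b, by rw [add_smul]; exact SetLike.mul_mem_graded ha hb, ?_⟩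
    rw [Localization.mk_mul]
    congr 1
    ext
    simp [conePow, pow_add]

/-! ### Graded modules and their sheaves

For a `Pic(X)`-graded `S`-module `M`, the quasi-coherent sheaf `M~` on `X` is given on the affine
open cover of `X` by the charts `U_σ`, where `U_σ ∩ U_τ = U_{σ ∩ τ}`: its module of sections on
`U_σ` is the degree zero part of the localization of `M` at `coneMonomial σ`. -/

section Sheaf

variable {M : Type*} [AddCommGroup M] [Module (X.Cox k) M] (ℳ : X.Pic → AddSubgroup M)
  [SetLike.GradedSMul (X.coxGrading k) ℳ]
variable {N : Type*} [AddCommGroup N] [Module (X.Cox k) N] (𝒩 : X.Pic → AddSubgroup N)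
  [SetLike.GradedSMul (X.coxGrading k) 𝒩]

lemma smul_mem_graded {α β γ : X.Pic} (h : γ = α + β) {a : X.Cox k} {m : M}
    (ha : a ∈ X.coxGrading k α) (hm : m ∈ ℳ β) : a • m ∈ ℳ γ := by
  subst h
  exact SetLike.GradedSMul.smul_mem ha hm

/-- The sections of `M~` on the chart `U_σ`, as a module over the coordinate ring of `U_σ`. -/
noncomputable def sections (σ : Finset R) :
    Submodule (X.chartRing k σ) (LocalizedModule (X.coneSub k σ) M) where
  carrier := {z | ∃ n : ℕ, ∃ m ∈ ℳ (n • X.coneDeg σ), z = LocalizedModule.mk m (X.conePow k σ n)}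
  zero_mem' := ⟨0, 0, zero_mem _, (LocalizedModule.zero_mk _).symm⟩
  add_mem' := by
    rintro _ _ ⟨n, a, ha, rfl⟩ ⟨m, b, hb, rfl⟩
    refine ⟨n + m, X.coneMonomial k σ ^ m • a + X.coneMonomial k σ ^ n • b,
      add_mem ?_ ?_, ?_⟩
    · exact X.smul_mem_graded k ℳ (by rw [add_comm, add_smul]) (X.coneMonomial_pow_mem k σ m) ha
    · exact X.smul_mem_graded k ℳ (by rw [add_smul]) (X.coneMonomial_pow_mem k σ n) hb
    · rw [LocalizedModule.mk_add_mk]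
      congr 1
      ext
      simp [conePow, pow_add]
  smul_mem' := by
    rintro ⟨_, n, a, ha, rfl⟩ _ ⟨m, b, hb, rfl⟩
    refine ⟨n + m, a • b, X.smul_mem_graded k ℳ (by rw [add_smul]) ha hb, ?_⟩
    rw [Subring.smul_def]
    refine (LocalizedModule.mk_smul_mk a b _ _).trans ?_
    congr 1
    ext
    simp [conePow, pow_add]

/-- For `τ ⊆ σ`, powers of `coneMonomial σ` are invertible on the localization at
`coneMonomial τ`. -/
lemma isUnit_coneSub {σ τ : Finset R} (h : τ ⊆ σ) (s : X.coneSub k σ) :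
    IsUnit (algebraMap (X.Cox k)
      (Module.End (X.Cox k) (LocalizedModule (X.coneSub k τ) M)) s) := by
  obtain ⟨_, n, rfl⟩ := s
  have h1 := IsLocalizedModule.map_units
    (LocalizedModule.mkLinearMap (X.coneSub k τ) M) (X.conePow k τ n)
  have h2 : ((X.conePow k τ n : X.coneSub k τ) : X.Cox k) =
      (∏ ρ ∈ σ \ τ, MvPolynomial.X ρ) ^ n * X.coneMonomial k σ ^ n := by
    rw [← mul_pow, ← X.coneMonomial_mul k h]
    rfl
  rw [h2, map_mul] at h1
  exact (((Commute.all _ _).map (algebraMap (X.Cox k)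
    (Module.End (X.Cox k) (LocalizedModule (X.coneSub k τ) M)))).isUnit_mul_iff.mp h1).2

/-- For `τ ⊆ σ`, the canonical map from the localization at `coneMonomial σ` to the localization
at its multiple `coneMonomial τ`. -/
noncomputable def locRes (M : Type*) [AddCommGroup M] [Module (X.Cox k) M]
    {σ τ : Finset R} (h : τ ⊆ σ) :
    LocalizedModule (X.coneSub k σ) M →ₗ[X.Cox k] LocalizedModule (X.coneSub k τ) M :=
  LocalizedModule.lift (X.coneSub k σ) (LocalizedModule.mkLinearMap (X.coneSub k τ) M)
    (X.isUnit_coneSub k h)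

lemma locRes_mk {σ τ : Finset R} (h : τ ⊆ σ) (m : M) (n : ℕ) :
    X.locRes k M h (LocalizedModule.mk m (X.conePow k σ n)) =
      LocalizedModule.mk ((∏ ρ ∈ σ \ τ, MvPolynomial.X ρ : X.Cox k) ^ n • m)
        (X.conePow k τ n) := by
  rw [locRes, LocalizedModule.lift_mk, Module.End.algebraMap_isUnit_inv_apply_eq_iff,
    LocalizedModule.mkLinearMap_apply, LocalizedModule.smul'_mk, LocalizedModule.mk_eq]
  refine ⟨1, ?_⟩
  simp only [one_smul, Submonoid.smul_def, conePow, smul_smul, X.coneMonomial_mul k h, mul_pow]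
  congr 1
  ring

/-- The restriction map of `M~` from the chart `U_σ` to the smaller chart `U_τ`, `τ ⊆ σ`. -/
noncomputable def sectionsRes {σ τ : Finset R} (h : τ ⊆ σ) (z : X.sections k ℳ σ) :
    X.sections k ℳ τ :=
  ⟨X.locRes k M h z, by
    obtain ⟨_, n, m, hm, rfl⟩ := z
    refine ⟨n, _, ?_, X.locRes_mk k h m n⟩
    refine X.smul_mem_graded k ℳ ?_ (SetLike.pow_mem_graded n (X.prod_X_mem k (σ \ τ))) hm
    rw [← smul_add, ← X.coneDeg_add h]⟩

/-- A morphism of sheaves `M~ → N~`: linear maps on the sections over all charts, compatible with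
restriction. -/
structure SheafHom where
  /-- the map on sections over `U_σ` -/
  app : ∀ σ ∈ X.cones, X.sections k ℳ σ →ₗ[X.chartRing k σ] X.sections k 𝒩 σ
  naturality : ∀ σ (hσ : σ ∈ X.cones) τ (hτ : τ ∈ X.cones) (h : τ ⊆ σ) (z : X.sections k ℳ σ),
    app τ hτ (X.sectionsRes k ℳ h z) = X.sectionsRes k 𝒩 h (app σ hσ z)

/-- The map induced on sections over `U_σ` by a degree zero homomorphism of graded modules. -/
noncomputable def sectionsMap (f : M →ₗ[X.Cox k] N) (hf : ∀ α, ∀ m ∈ ℳ α, f m ∈ 𝒩 α)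
    (σ : Finset R) : X.sections k ℳ σ →ₗ[X.chartRing k σ] X.sections k 𝒩 σ :=
  LinearMap.restrict
    ((LocalizedModule.map (X.coneSub k σ) f).restrictScalars (X.chartRing k σ)) (by
      rintro _ ⟨n, m, hm, rfl⟩
      exact ⟨n, f m, hf _ m hm, by simp [LocalizedModule.map_mk]⟩)

/-- The sheaf `M~` is not zero. -/
def SheafNeZero : Prop := ∃ σ ∈ X.cones, Nontrivial (X.sections k ℳ σ)

end Sheaf

/-! ### Virtual resolutions -/

/-- The grading of the free module `⨁ⱼ S(-aⱼ)`, whose `j`-th basis vector has degree `aⱼ`. -/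
noncomputable def freeGrading {b : ℕ} (a : Fin b → X.Pic) (α : X.Pic) :
    AddSubgroup (Fin b → X.Cox k) where
  carrier := {x | ∀ j, x j ∈ X.coxGrading k (α - a j)}
  zero_mem' _ := zero_mem _
  add_mem' hx hy j := add_mem (hx j) (hy j)
  neg_mem' hx j := neg_mem (hx j)

instance {b : ℕ} (a : Fin b → X.Pic) :
    SetLike.GradedSMul (X.coxGrading k) (X.freeGrading k a) where
  smul_mem {α β s x} hs hx j := by
    have := SetLike.mul_mem_graded hs (hx j)
    rwa [← add_sub_assoc] at this

/-- A complex `F₀ ← F₁ ← F₂ ← ⋯` of finitely generated `Pic(X)`-graded free `S`-modules, with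
`Fᵢ = ⨁ⱼ S(-aᵢⱼ)` and differentials of degree zero. -/
structure FreeComplex where
  rank : ℕ → ℕ
  twist : ∀ i, Fin (rank i) → X.Pic
  diff : ∀ i, (Fin (rank (i + 1)) → X.Cox k) →ₗ[X.Cox k] (Fin (rank i) → X.Cox k)
  diff_deg : ∀ i α, ∀ x ∈ X.freeGrading k (twist (i + 1)) α,
    diff i x ∈ X.freeGrading k (twist i) α
  diff_comp_diff : ∀ i, diff i ∘ₗ diff (i + 1) = 0

namespace FreeComplex

variable {X k}

/-- The grading of the `i`-th term of the complex. -/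
noncomputable abbrev grading (F : X.FreeComplex k) (i : ℕ) :
    X.Pic → AddSubgroup (Fin (F.rank i) → X.Cox k) := X.freeGrading k (F.twist i)

/-- The differential of the complex of sheaves `F~`, on the chart `U_σ`. -/
noncomputable def sheafDiff (F : X.FreeComplex k) (i : ℕ) (σ : Finset R) :
    X.sections k (F.grading (i + 1)) σ →ₗ[X.chartRing k σ] X.sections k (F.grading i) σ :=
  X.sectionsMap k _ _ (F.diff i) (F.diff_deg i) σ

/-- `F` is a virtual resolution of `M`: for some morphism of sheaves `ε : F₀~ → M~`, the
augmented complex of sheaves `0 ← M~ ← F₀~ ← F₁~ ← ⋯` is exact. -/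
def IsVirtualResolution (F : X.FreeComplex k)
    {M : Type*} [AddCommGroup M] [Module (X.Cox k) M] (ℳ : X.Pic → AddSubgroup M)
    [SetLike.GradedSMul (X.coxGrading k) ℳ] : Prop :=
  ∃ ε : X.SheafHom k (F.grading 0) ℳ, ∀ σ (hσ : σ ∈ X.cones),
    Function.Surjective (ε.app σ hσ) ∧
    Function.Exact (F.sheafDiff 0 σ) (ε.app σ hσ) ∧
    ∀ i, Function.Exact (F.sheafDiff (i + 1) σ) (F.sheafDiff i σ)

/-- `Fᵢ = 0` for all `i > n`. -/
def HasLengthLE (F : X.FreeComplex k) (n : ℕ) : Prop := ∀ i, n < i → F.rank i = 0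

end FreeComplex

section CohenMacaulay

variable {M : Type*} [AddCommGroup M] [Module (X.Cox k) M] (ℳ : X.Pic → AddSubgroup M)
  [SetLike.GradedSMul (X.coxGrading k) ℳ]

/-- The virtual dimension of `M`: the minimal length of a virtual resolution of `M`. -/
noncomputable def vdim : ℕ∞ :=
  sInf {l | ∃ (F : X.FreeComplex k) (n : ℕ), F.IsVirtualResolution ℳ ∧ F.HasLengthLE n ∧ l = n}

/-- The codimension of `M`, i.e. the codimension of `Spec (S / Ann M)` in `Spec S`. -/
noncomputable def codim (M : Type*) [AddCommGroup M] [Module (X.Cox k) M] : ℕ∞ :=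
  (Module.annihilator (X.Cox k) M).height

/-- `M` is arithmetically Cohen–Macaulay: it is a Cohen–Macaulay `S`-module. -/
def IsArithmeticallyCM (M : Type*) [AddCommGroup M] [Module (X.Cox k) M] : Prop :=
  IsCohenMacaulayModule (X.Cox k) M

/-- `M` is virtually Cohen–Macaulay: `M~ ≠ 0` and `vdim M = codim M`. -/
def IsVirtuallyCM : Prop := X.SheafNeZero k ℳ ∧ X.vdim k ℳ = X.codim k M

/-- An ideal is relevant if it contains no power `B^t`, `t ≥ 1`, of the irrelevant ideal. -/
def IsRelevant (I : Ideal (X.Cox k)) : Prop := ∀ t : ℕ, 1 ≤ t → ¬ X.irrelevantIdeal k ^ t ≤ I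

/-- `M` is geometrically Cohen–Macaulay: `M_P` is Cohen–Macaulay for all relevant primes `P` in
the support of `M`. -/
def IsGeometricallyCM (M : Type*) [AddCommGroup M] [Module (X.Cox k) M] : Prop :=
  ∀ P ∈ Module.support (X.Cox k) M, X.IsRelevant k P.asIdeal → IsCohenMacaulayAt (X.Cox k) M P

end CohenMacaulay

end SmoothProjectiveFan

/-! Both implications are instances of the Auslander–Buchsbaum formula, applied at relevant primes
for one and at the origin of `Spec S` for the other. Depth bounds move along exact sequences by
means of the characterization of depth through vanishing of `Ext` from the residue field
(`HasDepthGE.iff_ext`).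

Relevant primes. If `P` is relevant, some `coneMonomial σ` lies outside `P`. By smoothness every
degree is the degree of a unit on the chart `U_σ`, so exactness of the sheaf complex on `U_σ` gives
exactness of the localized modules: at `P` a virtual resolution of length `n` is a free resolution
of `M_P`. As `S_P` is Cohen–Macaulay, depth `M_P` is at least `ht P - n`
(`hasDepthGE_of_isVirtualResolution`). At a relevant minimal prime of the annihilator, where `M_P`
has dimension zero, this forces `codim M ≤ n`, hence `codim M ≤ vdim M`. If `n = codim M`, then at
every relevant `P` in the support `dim M_P ≤ ht P - n ≤ depth M_P`, so `M_P` is Cohen–Macaulay.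

The origin. Completeness of the fan gives a positive weight on `Pic(X)`, so a polynomial with
nonzero constant term is a nonzerodivisor on every graded module and localization at the origin
loses nothing. The minimal graded free resolution stays minimal there. The local ring is regular of
dimension `#R`, so a syzygy of depth `#R` is free and the resolution of a module of depth `δ` at the
origin stops at step `#R - δ` (`exists_freeComplex_hasLengthLE`). If `M` is Cohen–Macaulay, `δ` is
its dimension at the origin, and the dimension formula gives `#R - δ ≤ codim M`
(`card_le_codim_add_supportDim`). Hence `vdim M ≤ codim M`. -/

set_option linter.unusedSectionVars false

universe u v w

/-! ### Depth over Noetherian local rings -/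

section

open IsLocalRing RingTheory.Sequence CategoryTheory CategoryTheory.Abelian Pointwise

/-- The module `N` over the local ring `A` is zero or has a regular sequence of length `n` in the
maximal ideal, i.e. its depth is at least `n`. -/
def HasDepthGE (A : Type*) [CommRing A] [IsLocalRing A] (N : Type*) [AddCommGroup N] [Module A N]
    (n : ℕ) : Prop :=
  Subsingleton N ∨ ∃ rs : List A, rs.length = n ∧ (∀ r ∈ rs, r ∈ maximalIdeal A) ∧ IsRegular N rs

namespace HasDepthGE

variable {A : Type u} [CommRing A] [IsLocalRing A]

lemma congr {N : Type v} [AddCommGroup N] [Module A N] {N' : Type w} [AddCommGroup N'] [Module A N']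
    (e : N ≃ₗ[A] N') {n : ℕ} (h : HasDepthGE A N n) : HasDepthGE A N' n := by
  rcases h with h | ⟨rs, h1, h2, h3⟩
  · exact Or.inl e.symm.toEquiv.subsingleton
  · exact Or.inr ⟨rs, h1, h2, (e.isRegular_congr rs).mp h3⟩

lemma zero (N : Type v) [AddCommGroup N] [Module A N] : HasDepthGE A N 0 := by
  rcases subsingleton_or_nontrivial N with hN | hN
  · exact Or.inl hN
  · exact Or.inr ⟨[], rfl, by simp, IsRegular.nil A N⟩

variable [IsNoetherianRing A]

/-- This is Rees's theorem, with the zero module allowed on both sides. It makes long exact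
sequences of `Ext` available and shows that the bound does not depend on the choice of a sequence,
whence `mono`. -/
lemma iff_ext (N : Type u) [AddCommGroup N] [Module A N] [Module.Finite A N] (n : ℕ) :
    HasDepthGE A N n ↔ ∀ i < n, Subsingleton
      (Ext (ModuleCat.of A (A ⧸ maximalIdeal A)) (ModuleCat.of A N) i) := by
  rcases subsingleton_or_nontrivial N with hN | hN
  · refine ⟨fun _ i _ => ?_, fun _ => Or.inl hN⟩
    have h0 : 𝟙 (ModuleCat.of A N) = 0 := (ModuleCat.isZero_of_subsingleton _).eq_of_src _ _
    refine subsingleton_of_forall_eq 0 fun a => ?_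
    rw [← a.comp_mk₀_id, h0, Ext.mk₀_zero, Ext.comp_zero]
  · have hlt : maximalIdeal A • (⊤ : Submodule A N) < ⊤ :=
      lt_top_iff_ne_top.mpr (Submodule.top_ne_ideal_smul_of_le_jacobson_annihilator
        (IsLocalRing.maximalIdeal_le_jacobson _)).symm
    have supp : Module.support A (A ⧸ maximalIdeal A) =
        PrimeSpectrum.zeroLocus (maximalIdeal A) := by
      rw [Module.support_eq_zeroLocus, Ideal.annihilator_quotient]
    constructor
    · rintro (h' | ⟨rs, rfl, h1, h2⟩)
      · exact absurd h' (not_subsingleton N)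
      · exact ModuleCat.subsingleton_ext_of_exists_isRegular (maximalIdeal A)
          (ModuleCat.of A (A ⧸ maximalIdeal A)) supp.subset (ModuleCat.of A N) hlt rs h1 h2
    · intro h'
      exact Or.inr (ModuleCat.exists_isRegular_of_exists_subsingleton_ext (maximalIdeal A) n
        (ModuleCat.of A N) hlt (ModuleCat.of A (A ⧸ maximalIdeal A)) supp h')

lemma mono {N : Type v} [AddCommGroup N] [Module A N] {n m : ℕ} (h : HasDepthGE A N n)
    [Module.Finite A N] (hm : m ≤ n) : HasDepthGE A N m := by
  have : Small.{u} N := Module.Finite.small.{u} A N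
  have h' := (iff_ext _ n).mp (h.congr (Shrink.linearEquiv A N).symm)
  exact ((iff_ext _ m).mpr fun i hi => h' i (hi.trans_le hm)).congr (Shrink.linearEquiv A N)

section ShortExact

variable {K F N : Type u} [AddCommGroup K] [Module A K] [Module.Finite A K]
  [AddCommGroup F] [Module A F] [Module.Finite A F] [AddCommGroup N] [Module A N]
  [Module.Finite A N] (f : K →ₗ[A] F) (g : F →ₗ[A] N) (hf : Function.Injective f)
  (hg : Function.Surjective g) (hfg : Function.Exact f g)

include hf hg hfg

lemma shortExact_moduleCat : (ShortComplex.mk (ModuleCat.ofHom f) (ModuleCat.ofHom g)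
    (by rw [← ModuleCat.ofHom_comp, hfg.linearMap_comp_eq_zero]; rfl)).ShortExact :=
  { exact := (ShortComplex.ShortExact.moduleCat_exact_iff_function_exact _).mpr hfg
    mono_f := (ModuleCat.mono_iff_injective _).mpr hf
    epi_g := (ModuleCat.epi_iff_surjective _).mpr hg }

/-- `Ext^i` into `N` sits between `Ext^i` into `F` and `Ext^(i+1)` into `K`, and both vanish for `i
< n`. -/
lemma quotient_aux {n : ℕ} (hF : HasDepthGE A F n) (hK : HasDepthGE A K (n + 1)) :
    HasDepthGE A N n := by
  rw [iff_ext] at *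
  have S := shortExact_moduleCat f g hf hg hfg
  intro i hi
  refine subsingleton_of_forall_eq 0 fun x => ?_
  have := hK (i + 1) (by omega)
  have := hF i hi
  obtain ⟨y, rfl⟩ := Ext.covariant_sequence_exact₃ _ S x (n₁ := i + 1) rfl
    (Subsingleton.elim (α := Ext _ (ModuleCat.of A K) (i + 1)) _ _)
  rw [Subsingleton.elim (α := Ext _ (ModuleCat.of A F) i) y 0, Ext.zero_comp]

/-- `Ext^(i+1)` into `K` sits between `Ext^i` into `N` and `Ext^(i+1)` into `F`; in degree zero,
maps into `K` embed into maps into `F`. -/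
lemma kernel_aux {n : ℕ} (hF : HasDepthGE A F (n + 1)) (hN : HasDepthGE A N n) :
    HasDepthGE A K (n + 1) := by
  rw [iff_ext] at *
  have S := shortExact_moduleCat f g hf hg hfg
  intro i hi
  refine subsingleton_of_forall_eq 0 fun x => ?_
  have := hF i hi
  cases i with
  | zero =>
    have hm : Mono (ModuleCat.ofHom f) := S.mono_f
    apply Ext.postcomp_mk₀_injective_of_mono _ (ModuleCat.ofHom f)
    exact Subsingleton.elim (α := Ext _ (ModuleCat.of A F) 0) _ _
  | succ i =>
    have := hN i (by omega)
    obtain ⟨y, rfl⟩ := Ext.covariant_sequence_exact₁ _ S x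
      (Subsingleton.elim (α := Ext _ (ModuleCat.of A F) (i + 1)) _ _) (n₀ := i) rfl
    rw [Subsingleton.elim (α := Ext _ (ModuleCat.of A N) i) y 0, Ext.zero_comp]

end ShortExact

section ShortExactPoly

variable {K : Type v} {F : Type w} {N : Type*} [AddCommGroup K] [Module A K] [Module.Finite A K]
  [AddCommGroup F] [Module A F] [Module.Finite A F] [AddCommGroup N] [Module A N]
  [Module.Finite A N] (f : K →ₗ[A] F) (g : F →ₗ[A] N) (hf : Function.Injective f)
  (hg : Function.Surjective g) (hfg : Function.Exact f g)

include hf hg hfg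

/-- `iff_ext` requires modules in the universe of `A`. Finite modules are small there, so a short
exact sequence can be moved into it. -/
lemma exists_shrink : ∃ (_ : Small.{u} K) (_ : Small.{u} F) (_ : Small.{u} N)
    (f' : Shrink.{u} K →ₗ[A] Shrink.{u} F) (g' : Shrink.{u} F →ₗ[A] Shrink.{u} N),
    Function.Injective f' ∧ Function.Surjective g' ∧ Function.Exact f' g' := by
  have hK : Small.{u} K := Module.Finite.small.{u} A K
  have hF : Small.{u} F := Module.Finite.small.{u} A F
  have hN : Small.{u} N := Module.Finite.small.{u} A N
  let eK := Shrink.linearEquiv A K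
  let eF := Shrink.linearEquiv A F
  let eN := Shrink.linearEquiv A N
  refine ⟨hK, hF, hN, eF.symm ∘ₗ f ∘ₗ eK, eN.symm ∘ₗ g ∘ₗ eF, ?_, ?_, ?_⟩
  · simpa using hf
  · simpa using hg
  · intro y
    have := hfg (eF y)
    simp only [LinearMap.comp_apply, LinearEquiv.coe_coe, EmbeddingLike.map_eq_zero_iff, this]
    constructor
    · rintro ⟨x, hx⟩
      exact ⟨eK.symm x, by simp [hx]⟩
    · rintro ⟨x, rfl⟩
      exact ⟨eK x, by simp⟩

lemma quotient {n : ℕ} (hF : HasDepthGE A F n) (hK : HasDepthGE A K (n + 1)) :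
    HasDepthGE A N n := by
  obtain ⟨_, _, _, f', g', h1, h2, h3⟩ := exists_shrink f g hf hg hfg
  exact (quotient_aux f' g' h1 h2 h3 (hF.congr (Shrink.linearEquiv A F).symm)
    (hK.congr (Shrink.linearEquiv A K).symm)).congr (Shrink.linearEquiv A N)

lemma kernel {n : ℕ} (hF : HasDepthGE A F (n + 1)) (hN : HasDepthGE A N n) :
    HasDepthGE A K (n + 1) := by
  obtain ⟨_, _, _, f', g', h1, h2, h3⟩ := exists_shrink f g hf hg hfg
  exact (kernel_aux f' g' h1 h2 h3 (hF.congr (Shrink.linearEquiv A F).symm)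
    (hN.congr (Shrink.linearEquiv A N).symm)).congr (Shrink.linearEquiv A K)

end ShortExactPoly

lemma quotSMulTop {N : Type v} [AddCommGroup N] [Module A N] [Module.Finite A N] {x : A}
    (hx : IsSMulRegular N x) {n : ℕ} (h : HasDepthGE A N (n + 1)) :
    HasDepthGE A (QuotSMulTop x N) n :=
  quotient (LinearMap.lsmul A N x) (Submodule.mkQ (x • (⊤ : Submodule A N))) hx
    (Submodule.mkQ_surjective _) (LinearMap.exact_lsmul_mkQ_smul_top N x) (h.mono n.le_succ) h

-- Tensoring with the flat module `F` keeps a regular sequence weakly regular; Nakayama's lemma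
-- upgrades this to regular because `F` is finite and nonzero.
omit [IsNoetherianRing A] in
lemma free {n : ℕ} (h : HasDepthGE A A n) (F : Type v) [AddCommGroup F] [Module A F]
    [Module.Finite A F] [Module.Free A F] : HasDepthGE A F n := by
  rcases subsingleton_or_nontrivial F with hF | hF
  · exact Or.inl hF
  · rcases h with h | ⟨rs, h1, h2, h3⟩
    · exact absurd h (not_subsingleton A)
    · refine Or.inr ⟨rs, h1, h2, ?_⟩
      rw [IsLocalRing.isRegular_iff_isWeaklyRegular_of_subset_maximalIdeal h2]
      exact ((TensorProduct.rid A F).isWeaklyRegular_congr rs).mp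
        (h3.toIsWeaklyRegular.isWeaklyRegular_lTensor (M₂ := F))

lemma le_supportDim {N : Type v} [AddCommGroup N] [Module A N] [Module.Finite A N] [Nontrivial N]
    {n : ℕ} (h : HasDepthGE A N n) : (n : WithBot ℕ∞) ≤ Module.supportDim A N := by
  rcases h with h | ⟨rs, rfl, h2, h3⟩
  · exact absurd h (not_subsingleton N)
  · rw [← Module.supportDim_add_length_eq_supportDim_of_isRegular rs h3]
    have : Nontrivial (N ⧸ Ideal.ofList rs • (⊤ : Submodule A N)) := h3.quot_ofList_smul_nontrivial ⊤
    have h0 : 0 ≤ Module.supportDim A (N ⧸ Ideal.ofList rs • (⊤ : Submodule A N)) := by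
      have := Module.supportDim_ne_bot_of_nontrivial A (N ⧸ Ideal.ofList rs • (⊤ : Submodule A N))
      generalize Module.supportDim A (N ⧸ Ideal.ofList rs • (⊤ : Submodule A N)) = z at *
      induction z with
      | bot => exact absurd rfl this
      | coe z => exact WithBot.coe_nonneg.mpr (zero_le)
    exact le_add_of_nonneg_left h0

end HasDepthGE

/-- This is the depth half of Auslander–Buchsbaum: the kernel of the augmentation has a resolution
one step shorter, and passing from it to the cokernel costs one unit of depth. For `r ≤ n` the
truncated subtraction makes the claim empty. -/
lemma HasDepthGE.of_resolution {A : Type u} [CommRing A] [IsLocalRing A] [IsNoetherianRing A]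
    {r : ℕ} (hA : HasDepthGE A A r) (n : ℕ) {N : Type w} [AddCommGroup N] [Module A N]
    [Module.Finite A N]
    (F : ℕ → Type v) [∀ i, AddCommGroup (F i)] [∀ i, Module A (F i)] [∀ i, Module.Finite A (F i)]
    [∀ i, Module.Free A (F i)] (f : ∀ i, F (i + 1) →ₗ[A] F i) (g : F 0 →ₗ[A] N)
    (hg : Function.Surjective g) (hfg : Function.Exact (f 0) g)
    (hf : ∀ i, Function.Exact (f (i + 1)) (f i)) (hF : ∀ i, n < i → Subsingleton (F i)) :
    HasDepthGE A N (r - n) := by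
  -- The syzygies live in the universe of the `F i`, so the induction runs over modules there, and
  -- `N` enters only as a quotient of `F 0`.
  suffices H : ∀ K : Type v, ∀ (_ : AddCommGroup K) (_ : Module A K) (_ : Module.Finite A K)
      (g : F 0 →ₗ[A] K), Function.Surjective g → Function.Exact (f 0) g →
      HasDepthGE A K (r - n) by
    have e := g.quotKerEquivOfSurjective hg
    refine (H (F 0 ⧸ LinearMap.ker g) inferInstance inferInstance inferInstance
      (LinearMap.ker g).mkQ (Submodule.mkQ_surjective _) ?_).congr e
    rw [LinearMap.exact_iff] at hfg ⊢
    rw [Submodule.ker_mkQ, hfg]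
  clear hfg hg g
  induction n generalizing F with
  | zero =>
    intro K _ _ _ g hg hfg
    have := hF 1 Nat.one_pos
    have hinj : Function.Injective g := by
      rw [injective_iff_map_eq_zero]
      intro a ha
      obtain ⟨b, rfl⟩ := (hfg a).mp ha
      rw [Subsingleton.elim b 0, map_zero]
    exact (hA.free (F 0)).congr (LinearEquiv.ofBijective g ⟨hinj, hg⟩)
  | succ n ih =>
    intro K _ _ _ g hg hfg
    rcases Nat.lt_or_ge n r with hr | hr
    swap
    · rw [Nat.sub_eq_zero_of_le (by omega)]
      exact zero K
    have hK := ih (fun i => F (i + 1)) (fun i => f (i + 1)) (fun i => hf (i + 1))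
      (fun i hi => hF (i + 1) (by omega)) (LinearMap.ker g) inferInstance inferInstance
      inferInstance ((f 0).codRestrict (LinearMap.ker g) fun c => (hfg _).mpr ⟨c, rfl⟩) ?_ ?_
    · have e : r - n = r - (n + 1) + 1 := by omega
      rw [e] at hK
      exact quotient (LinearMap.ker g).subtype g (Submodule.subtype_injective _) hg
        (LinearMap.exact_subtype_ker_map g) ((hA.mono (Nat.sub_le _ _)).free (F 0)) hK
    · rintro ⟨y, hy⟩
      obtain ⟨x, rfl⟩ := (hfg y).mp hy
      exact ⟨x, rfl⟩
    · intro y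
      rw [← hf 0 y]
      exact Subtype.ext_iff

/-! ### Associated primes and regular sequences -/

section AssociatedPrime

variable {A : Type u} [CommRing A] [IsLocalRing A] [IsNoetherianRing A]

/-- The length of a regular sequence on `N` is at most the dimension of `A ⧸ Q` for every
associated prime `Q` of `N`. -/
lemma length_le_ringKrullDim_quotient_of_mem_associatedPrimes (rs : List A)
    (hrs : ∀ r ∈ rs, r ∈ maximalIdeal A) {N : Type v} [AddCommGroup N] [Module A N]
    [Module.Finite A N] (reg : IsWeaklyRegular N rs) {Q : Ideal A} (hQ : Q ∈ associatedPrimes A N) :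
    (rs.length : WithBot ℕ∞) ≤ ringKrullDim (A ⧸ Q) := by
  induction rs generalizing N Q with
  | nil =>
    have := hQ.isPrime
    simpa using ringKrullDim_nonneg_of_nontrivial
  | cons x rs ih =>
    have hQp := hQ.isPrime
    obtain ⟨hx, hreg⟩ := (isWeaklyRegular_cons_iff N x rs).mp reg
    have hxm := hrs x (by simp)
    -- `U` is nonzero since `Q` is associated. It is not inside `xN`: otherwise regularity of `x`
    -- would give `U = xU`, and Nakayama's lemma `U = 0`.
    let U : Submodule A N := Submodule.torsionBySet A N Q
    have hU0 : U ≠ ⊥ := by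
      obtain ⟨-, y, hy⟩ := isAssociatedPrime_iff.mp hQ
      intro hU
      have hyU : y ∈ U := by
        rw [Submodule.mem_torsionBySet_iff]
        rintro ⟨a, ha⟩
        rw [hy] at ha
        simpa using ha
      rw [hU, Submodule.mem_bot] at hyU
      apply hQp.ne_top
      rw [hy, hyU]
      ext; simp
    have hUx : ¬ U ≤ x • (⊤ : Submodule A N) := by
      intro hle
      apply hU0
      refine Submodule.eq_bot_of_le_smul_of_le_jacobson_bot (Ideal.span {x}) U
        (IsNoetherian.noetherian U) ?_ ?_
      · intro u hu
        obtain ⟨v, -, rfl⟩ := (Submodule.mem_smul_pointwise_iff_exists _ _ _).mp (hle hu)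
        rw [Submodule.ideal_span_singleton_smul]
        refine Submodule.smul_mem_pointwise_smul _ _ _ ?_
        rw [Submodule.mem_torsionBySet_iff] at hu ⊢
        intro a
        apply hx
        have := hu a
        simp only [smul_zero]
        rw [smul_comm]
        exact this
      · rw [IsLocalRing.jacobson_eq_maximalIdeal ⊥ bot_ne_top]
        simpa using hxm
    obtain ⟨u, hu, hux⟩ := SetLike.not_le_iff_exists.mp hUx
    let u' : QuotSMulTop x N := Submodule.Quotient.mk u
    have hu' : u' ≠ 0 := by
      intro h
      exact hux ((Submodule.Quotient.mk_eq_zero _).mp h)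
    -- An associated prime of `N/xN` over the annihilator of the class of `u` contains `Q` and `x`,
    -- whereas `x ∉ Q` because `x` is regular. So each term of the sequence produces a strictly
    -- larger prime.
    obtain ⟨Q', hQ', hle⟩ := exists_le_isAssociatedPrime_of_isNoetherianRing A u' hu'
    have hQ'p := hQ'.isPrime
    have hQQ' : Q < Q' := by
      refine lt_of_le_of_ne (fun a ha => hle ?_) ?_
      · rw [Submodule.mem_torsionBySet_iff] at hu
        have := hu ⟨a, ha⟩
        simp only at this
        simp only [Submodule.mem_colon_singleton, Submodule.mem_bot]
        change (Submodule.Quotient.mk (a • u) : QuotSMulTop x N) = 0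
        rw [this]; rfl
      · rintro rfl
        have hxQ : x ∈ Q := by
          apply hle
          simp only [Submodule.mem_colon_singleton, Submodule.mem_bot]
          exact (Submodule.Quotient.mk_eq_zero _).mpr (Submodule.smul_mem_pointwise_smul _ _ _ trivial)
        have := biUnion_associatedPrimes_eq_compl_regular A N
        have h2 : x ∈ ⋃ p ∈ associatedPrimes A N, (p : Set A) := Set.mem_biUnion hQ hxQ
        rw [this] at h2
        exact h2 hx
    have h1 := ih (fun r hr => hrs r (by simp [hr])) hreg hQ'
    have h2 : ringKrullDim (A ⧸ Q') + 1 ≤ ringKrullDim (A ⧸ Q) := by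
      obtain ⟨a, ha, haQ⟩ := SetLike.exists_of_lt hQQ'
      refine ringKrullDim_succ_le_of_surjective (Ideal.Quotient.factor hQQ'.le)
        (Ideal.Quotient.factor_surjective hQQ'.le) (r := Ideal.Quotient.mk Q a) ?_ ?_
      · rw [mem_nonZeroDivisors_iff_ne_zero, Ne, Ideal.Quotient.eq_zero_iff_mem]
        exact haQ
      · simpa [Ideal.Quotient.eq_zero_iff_mem] using ha
    refine le_trans ?_ h2
    push_cast [List.length_cons]
    gcongr

/-- A regular sequence over `A` on a module over the local ring `A ⧸ I`, seen over `A ⧸ I`. -/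
lemma HasDepthGE.of_quotient {A : Type u} [CommRing A] [IsLocalRing A] {B : Type v} [CommRing B]
    [IsLocalRing B] [Algebra A B] [IsLocalHom (algebraMap A B)] {N : Type w} [AddCommGroup N]
    [Module A N] [Module B N] [IsScalarTower A B N] {n : ℕ} (h : HasDepthGE A N n) :
    HasDepthGE B N n := by
  rcases h with h | ⟨rs, h1, h2, h3⟩
  · exact Or.inl h
  · refine Or.inr ⟨rs.map (algebraMap A B), by simpa using h1, ?_, ?_⟩
    · intro r hr
      obtain ⟨a, ha, rfl⟩ := List.mem_map.mp hr
      exact (IsLocalRing.map_maximalIdeal_le (algebraMap A B)) (Ideal.mem_map_of_mem _ (h2 a ha))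
    · exact ((AddEquiv.refl N).isRegular_congr <| List.forall₂_map_left_iff.mpr <|
        List.forall₂_same.mpr fun r _ => algebraMap_smul B r).mpr h3

/-- In a Cohen–Macaulay local ring of dimension `n`, every prime `P` contains a regular sequence
of length at least `n - dim (A ⧸ P)`. -/
lemma exists_isWeaklyRegular_le_length_add_ringKrullDim (n : ℕ) {A : Type u} [CommRing A]
    [IsLocalRing A] [IsNoetherianRing A] (hA : HasDepthGE A A n) (hdim : ringKrullDim A ≤ n)
    (P : Ideal A) [P.IsPrime] :
    ∃ rs : List A, (∀ r ∈ rs, r ∈ P) ∧ IsWeaklyRegular A rs ∧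
      (n : WithBot ℕ∞) ≤ rs.length + ringKrullDim (A ⧸ P) := by
  induction n generalizing A with
  | zero =>
    exact ⟨[], by simp, .nil A A, by simpa using ringKrullDim_nonneg_of_nontrivial⟩
  | succ n ih =>
    -- If `P` lies in an associated prime `Q`, then `dim (A ⧸ P) ≥ dim (A ⧸ Q) ≥ n + 1` and the
    -- empty sequence suffices. If not, prime avoidance finds a regular element `x` in `P`, and the
    -- induction continues in `A ⧸ (x)`.
    by_cases hP : ∃ Q ∈ associatedPrimes A A, P ≤ Q
    · obtain ⟨Q, hQ, hPQ⟩ := hP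
      refine ⟨[], by simp, .nil A A, ?_⟩
      rcases hA with hA | ⟨rs, h1, h2, h3⟩
      · exact absurd hA (not_subsingleton A)
      · have h4 := length_le_ringKrullDim_quotient_of_mem_associatedPrimes rs h2
          h3.toIsWeaklyRegular hQ
        rw [h1] at h4
        simpa using h4.trans (ringKrullDim_le_of_surjective (Ideal.Quotient.factor hPQ)
          (Ideal.Quotient.factor_surjective hPQ))
    · have hx : ∃ x ∈ P, IsSMulRegular A x := by
        by_contra! h
        apply hP
        obtain ⟨I, hI⟩ := associatedPrimes.nonempty A A
        apply (Ideal.subset_union_prime_finite (associatedPrimes.finite A A) I I _).mp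
        · rw [biUnion_associatedPrimes_eq_compl_regular A A]
          exact fun r hr ↦ h r hr
        · exact fun I hin _ _ ↦ IsAssociatedPrime.isPrime hin
      obtain ⟨x, hxP, hx⟩ := hx
      have hxm : x ∈ maximalIdeal A := le_maximalIdeal (Ideal.IsPrime.ne_top ‹_›) hxP
      have : Nontrivial (A ⧸ Ideal.span {x}) := Ideal.Quotient.nontrivial_iff.mpr
        (by rw [Ne, Ideal.span_singleton_eq_top]; exact (mem_maximalIdeal x).mp hxm)
      have : IsLocalRing (A ⧸ Ideal.span {x}) := .of_surjective' _ Ideal.Quotient.mk_surjective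
      have hle : Ideal.span {x} ≤ P := by simpa using hxP
      let P' := P.map (Ideal.Quotient.mk (Ideal.span {x}))
      have : P'.IsPrime := Ideal.map_isPrime_of_surjective Ideal.Quotient.mk_surjective (by simpa)
      have : IsLocalHom (algebraMap A (A ⧸ Ideal.span {x})) :=
        IsLocalHom.of_surjective _ Ideal.Quotient.mk_surjective
      have e : QuotSMulTop x A ≃ₗ[A] A ⧸ Ideal.span {x} := Submodule.quotEquivOfEq _ _ (by
        rw [← Submodule.ideal_span_singleton_smul]; simp)
      have hd : ringKrullDim (A ⧸ Ideal.span {x}) ≤ n := by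
        have := ringKrullDim_quotient_span_singleton_succ_eq_ringKrullDim hx hxm
        rw [← this] at hdim
        push_cast at hdim
        exact (ENat.WithBot.add_le_add_one_right_iff).mp hdim
      obtain ⟨rs, h1, h2, h3⟩ := ih (A := A ⧸ Ideal.span {x})
        ((hA.quotSMulTop hx).congr e).of_quotient hd P'
      · obtain ⟨l, rfl⟩ : ∃ l : List A, l.map (algebraMap A (A ⧸ Ideal.span {x})) = rs :=
          List.map_surjective_iff.mpr Ideal.Quotient.mk_surjective rs
        refine ⟨x :: l, ?_, ?_, ?_⟩
        · simp only [List.mem_cons, forall_eq_or_imp, hxP, true_and]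
          intro r hr
          have := h1 _ (List.mem_map_of_mem hr)
          have := Ideal.mem_comap.mpr this
          rwa [Ideal.Quotient.algebraMap_eq, Ideal.comap_map_mk hle] at this
        · refine .cons hx ((e.isWeaklyRegular_congr l).mpr ?_)
          exact (isWeaklyRegular_map_algebraMap_iff (A ⧸ Ideal.span {x}) _ l).mp h2
        · rw [ringKrullDim_eq_of_ringEquiv (DoubleQuot.quotQuotEquivQuotOfLE hle)] at h3
          rw [List.length_map] at h3
          rw [List.length_cons]
          push_cast
          rw [add_right_comm]
          gcongr

end AssociatedPrime

/-- If the maximal ideal of `A` is generated by `n` elements then every finite module of depth at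
least `n` is free. -/
theorem Module.Free.of_hasDepthGE (n : ℕ) {A : Type u} [CommRing A] [IsLocalRing A]
    [IsNoetherianRing A] (y : Fin n → A) (hy : maximalIdeal A = Ideal.span (Set.range y))
    {N : Type v} [AddCommGroup N] [Module A N] [Module.Finite A N] (h : HasDepthGE A N n) :
    Module.Free A N := by
  induction n generalizing A N with
  | zero =>
    have hA : IsField A := by
      rw [IsLocalRing.isField_iff_maximalIdeal_eq, hy, Set.range_eq_empty, Ideal.span_empty]
    let := hA.toField
    infer_instance
  | succ n ih =>
    rcases subsingleton_or_nontrivial N with hN | hN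
    · infer_instance
    obtain ⟨r, hr, hrN⟩ : ∃ r ∈ maximalIdeal A, IsSMulRegular N r := by
      rcases h with h | ⟨rs, h1, h2, h3⟩
      · exact absurd h (not_subsingleton N)
      · obtain ⟨r, rs, rfl⟩ := List.exists_cons_of_length_eq_add_one h1
        exact ⟨r, h2 r (by simp), ((isRegular_cons_iff N r rs).mp h3).1⟩
    -- Prime avoidance over the associated primes together with the square of the maximal ideal,
    -- which is allowed as an exceptional nonprime member.
    have hx : ∃ x ∈ maximalIdeal A, x ∉ maximalIdeal A ^ 2 ∧ IsSMulRegular N x := by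
      by_contra! H
      have hsub : (maximalIdeal A : Set A) ⊆
          ⋃ I ∈ insert (maximalIdeal A ^ 2) (associatedPrimes A N), (I : Set A) := by
        intro x hx
        rw [Set.biUnion_insert, biUnion_associatedPrimes_eq_compl_regular A N]
        by_cases hx2 : x ∈ maximalIdeal A ^ 2
        · exact Or.inl hx2
        · exact Or.inr (H x hx hx2)
      obtain ⟨I, hI, hle⟩ := (Ideal.subset_union_prime_finite
        ((associatedPrimes.finite A N).insert (maximalIdeal A ^ 2)) (f := id)
        (maximalIdeal A ^ 2) (maximalIdeal A ^ 2)
        fun I hI h1 _ => IsAssociatedPrime.isPrime (hI.resolve_left h1)).mp hsub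
      rcases hI with rfl | hI
      -- If the maximal ideal equals its square it is zero by Nakayama's lemma; then `r = 0` would
      -- be regular on a nonzero module.
      · have : maximalIdeal A = ⊥ := by
          refine Submodule.eq_bot_of_le_smul_of_le_jacobson_bot (maximalIdeal A) _
            (IsNoetherian.noetherian _) ?_ (IsLocalRing.maximalIdeal_le_jacobson _)
          rwa [smul_eq_mul, ← sq]
        rw [this, Ideal.mem_bot] at hr
        subst hr
        exact not_subsingleton N (IsSMulRegular.zero_iff_subsingleton.mp hrN)
      · have h2 : r ∈ ⋃ p ∈ associatedPrimes A N, (p : Set A) := Set.mem_biUnion hI (hle hr)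
        rw [biUnion_associatedPrimes_eq_compl_regular A N] at h2
        exact h2 hrN
    obtain ⟨x, hxm, hx2, hxN⟩ := hx
    have hx' := hxm
    rw [hy, Ideal.mem_span_range_iff_exists_fun] at hx'
    obtain ⟨c, hc⟩ := hx'
    -- Since `x` is not in the square of the maximal ideal, one coefficient is a unit. The generator
    -- `y i` is then redundant modulo `x`, leaving `n` generators for the induction.
    obtain ⟨i, hi⟩ : ∃ i, IsUnit (c i) := by
      by_contra! H
      apply hx2
      rw [← hc, sq]
      refine Ideal.sum_mem _ fun i _ => Ideal.mul_mem_mul ((mem_maximalIdeal _).mpr (H i)) ?_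
      rw [hy]
      exact Ideal.subset_span ⟨i, rfl⟩
    have : Nontrivial (A ⧸ Ideal.span {x}) := Ideal.Quotient.nontrivial_iff.mpr
      (by rw [Ne, Ideal.span_singleton_eq_top]; exact (mem_maximalIdeal x).mp hxm)
    have : IsLocalRing (A ⧸ Ideal.span {x}) := .of_surjective' _ Ideal.Quotient.mk_surjective
    have : IsLocalHom (algebraMap A (A ⧸ Ideal.span {x})) :=
      IsLocalHom.of_surjective _ Ideal.Quotient.mk_surjective
    have hmax : maximalIdeal (A ⧸ Ideal.span {x}) = Ideal.span
        (Set.range fun j => Ideal.Quotient.mk (Ideal.span {x}) (y (i.succAbove j))) := by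
      have hmap : (maximalIdeal A).map (Ideal.Quotient.mk (Ideal.span {x})) =
          maximalIdeal (A ⧸ Ideal.span {x}) :=
        IsLocalRing.map_maximalIdeal_of_surjective _ Ideal.Quotient.mk_surjective
      rw [← hmap, hy, Ideal.map_span, ← Set.range_comp]
      refine le_antisymm (Ideal.span_le.mpr ?_) (Ideal.span_mono ?_)
      · rintro _ ⟨j, rfl⟩
        have key : ∀ j, Ideal.Quotient.mk (Ideal.span {x}) (y (i.succAbove j)) ∈ Ideal.span
            (Set.range fun j => Ideal.Quotient.mk (Ideal.span {x}) (y (i.succAbove j))) :=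
          fun j => Ideal.subset_span ⟨j, rfl⟩
        rcases Fin.eq_self_or_eq_succAbove i j with rfl | ⟨j, rfl⟩
        · have h0 : Ideal.Quotient.mk (Ideal.span {x}) (∑ i, c i * y i) = 0 := by
            rw [hc, Ideal.Quotient.eq_zero_iff_mem]
            exact Ideal.mem_span_singleton_self x
          rw [Fin.sum_univ_succAbove _ j, map_add, map_mul, map_sum, add_eq_zero_iff_eq_neg] at h0
          simp only [Function.comp_apply, SetLike.mem_coe]
          rw [← (Ideal.unit_mul_mem_iff_mem _ (hi.map (Ideal.Quotient.mk (Ideal.span {x})))), h0]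
          refine neg_mem (Ideal.sum_mem _ fun l _ => ?_)
          rw [map_mul]
          exact Ideal.mul_mem_left _ _ (key l)
        · exact key j
      · rintro _ ⟨j, rfl⟩
        exact ⟨_, rfl⟩
    have : Module.Finite (A ⧸ Ideal.span {x}) (QuotSMulTop x N) :=
      .of_restrictScalars_finite A _ _
    have hfree := ih _ hmax ((h.quotSMulTop hxN).of_quotient (B := A ⧸ Ideal.span {x}))
    have := Module.finitePresentation_of_finite A N
    -- Freeness of `N/xN` over `A ⧸ (x)` lifts to `N` because `x` is regular on `N` and lies in the
    -- Jacobson radical.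
    refine (Module.free_quotSMulTop_iff_free A N (x := x) ?_ hxN).mp hfree
    exact IsLocalRing.maximalIdeal_le_jacobson _ hxm

/-! ### Heights and localization of Cohen–Macaulay local rings -/

/-- Along a chain of primes containing `I`, the first has height at least that of `I` and each
further step raises the height by at least one. -/
lemma Ideal.height_add_ringKrullDim_quotient_le {A : Type*} [CommRing A] (I : Ideal A) :
    (I.height : WithBot ℕ∞) + ringKrullDim (A ⧸ I) ≤ ringKrullDim A := by
  rcases isEmpty_or_nonempty (PrimeSpectrum.zeroLocus (R := A) I) with h | h
  · rw [ringKrullDim_quotient, Order.krullDim_eq_bot, WithBot.add_bot]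
    exact bot_le
  rw [ringKrullDim_quotient, Order.krullDim_eq_iSup_length, ← WithBot.coe_add, ENat.add_iSup]
  have key : ∀ l : LTSeries (PrimeSpectrum.zeroLocus (R := A) I),
      I.height + l.length ≤ l.last.1.asIdeal.height := by
    intro l
    have hi : ∀ i : ℕ, ∀ hi : i < l.length + 1, I.height + i ≤ (l ⟨i, hi⟩).1.asIdeal.height := by
      intro i
      induction i with
      | zero =>
        intro hi
        simpa using Ideal.height_mono (l ⟨0, hi⟩).2
      | succ i ih =>
        intro hi
        have h1 := ih (by omega)
        have hlt : (l ⟨i, by omega⟩).1.asIdeal < (l ⟨i + 1, hi⟩).1.asIdeal :=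
          l.strictMono (a := ⟨i, by omega⟩) (b := ⟨i + 1, hi⟩) (by simp)
        have h2 := Ideal.height_add_one_le_of_lt_of_isPrime hlt
        push_cast
        rw [← add_assoc]
        exact (add_le_add_left h1 1).trans h2
    exact hi l.length (by omega)
  have : (⨆ l : LTSeries (PrimeSpectrum.zeroLocus (R := A) I), I.height + (l.length : ℕ∞)) ≤
      ⨆ l : LTSeries (PrimeSpectrum.zeroLocus (R := A) I), l.last.1.asIdeal.height :=
    iSup_mono key
  refine (WithBot.coe_le_coe.mpr this).trans ?_
  rw [WithBot.coe_iSup (OrderTop.bddAbove _)]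
  exact iSup_le fun l => Ideal.height_le_ringKrullDim_of_isPrime

section CohenMacaulayRing

variable {n : ℕ} {A : Type u} [CommRing A] [IsLocalRing A] [IsNoetherianRing A]
  (hA : HasDepthGE A A n) (hdim : ringKrullDim A ≤ n) (P : Ideal A) [P.IsPrime]

include hA hdim

/-- The regular sequence found in `P` stays regular in `A_P`, so its length is at most the height of
`P`. This is the nontrivial half of the dimension formula. -/
lemma HasDepthGE.natCast_le_height_add_ringKrullDim :
    (n : WithBot ℕ∞) ≤ P.height + ringKrullDim (A ⧸ P) := by
  obtain ⟨rs, h1, h2, h3⟩ := exists_isWeaklyRegular_le_length_add_ringKrullDim n hA hdim P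
  have h4 := h2.isRegular_of_isLocalization_of_mem (Localization.AtPrime P) P h1
  have h5 : HasDepthGE (Localization.AtPrime P) (Localization.AtPrime P) rs.length := by
    refine Or.inr ⟨_, List.length_map _, ?_, h4⟩
    intro r hr
    obtain ⟨a, ha, rfl⟩ := List.mem_map.mp hr
    exact (IsLocalization.AtPrime.to_map_mem_maximal_iff _ P a).mpr (h1 a ha)
  have h6 := h5.le_supportDim
  rw [Module.supportDim_self_eq_ringKrullDim,
    IsLocalization.AtPrime.ringKrullDim_eq_height P] at h6
  exact h3.trans (add_le_add_left h6 _)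

/-- The Cohen–Macaulay property localizes: the regular sequence in `P` has length at least `n - dim
(A ⧸ P)`, which is at least the height of `P`. -/
lemma HasDepthGE.localization {r : ℕ} (hr : (r : ℕ∞) ≤ P.height) :
    HasDepthGE (Localization.AtPrime P) (Localization.AtPrime P) r := by
  obtain ⟨rs, h1, h2, h3⟩ := exists_isWeaklyRegular_le_length_add_ringKrullDim n hA hdim P
  have h4 := h2.isRegular_of_isLocalization_of_mem (Localization.AtPrime P) P h1
  have h5 : HasDepthGE (Localization.AtPrime P) (Localization.AtPrime P) rs.length := by
    refine Or.inr ⟨_, List.length_map _, ?_, h4⟩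
    intro r hr
    obtain ⟨a, ha, rfl⟩ := List.mem_map.mp hr
    exact (IsLocalization.AtPrime.to_map_mem_maximal_iff _ P a).mpr (h1 a ha)
  refine h5.mono ?_
  have h6 := (P.height_add_ringKrullDim_quotient_le.trans hdim).trans h3
  have h7 : 0 ≤ ringKrullDim (A ⧸ P) := ringKrullDim_nonneg_of_nontrivial
  have h8 : ringKrullDim (A ⧸ P) ≤ n := (ringKrullDim_quotient_le P).trans hdim
  have h9 : ((r : ℕ∞) : WithBot ℕ∞) ≤ P.height := WithBot.coe_le_coe.mpr hr
  -- The dimension of `A ⧸ P` lies between `0` and `n`, so it is a natural number and can be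
  -- cancelled.
  generalize ringKrullDim (A ⧸ P) = z at *
  induction z with
  | bot => simp at h7
  | coe z =>
    induction z with
    | top => exact absurd (WithBot.coe_le_coe.mp h8) (by simp)
    | coe z =>
      have := (add_le_add_left h9 _).trans h6
      exact_mod_cast (ENat.WithBot.add_le_add_natCast_right_iff).mp this

end CohenMacaulayRing

/-- Transport of depth along a ring isomorphism. -/
lemma HasDepthGE.of_ringEquiv {A : Type u} [CommRing A] [IsLocalRing A] {B : Type v} [CommRing B]
    [IsLocalRing B] (e : A ≃+* B) {n : ℕ} (h : HasDepthGE A A n) : HasDepthGE B B n := by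
  let := e.toRingHom.toAlgebra
  have : IsLocalHom (algebraMap A B) := inferInstanceAs (IsLocalHom (e : A →+* B))
  let e' : A ≃ₗ[A] B := { e with map_smul' := fun a b => by simp [Algebra.smul_def]; rfl }
  exact (h.congr e').of_quotient

/-! ### Local rings of affine space -/

namespace MvPolynomial

variable {σ : Type u} [Fintype σ] {k : Type v} [Field k]

/-- Consequently a polynomial killed by the substitution lies in the ideal of the `X i - a i` with
`i ∈ T`; this serves as the membership test below. -/
lemma sub_aeval_ite_mem (a : σ → k) (T : Set σ) [DecidablePred (· ∈ T)] (f : MvPolynomial σ k) :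
    f - aeval (fun i => if i ∈ T then C (a i) else X i) f ∈
      Ideal.span ((fun i => (X i - C (a i) : MvPolynomial σ k)) '' T) := by
  induction f using MvPolynomial.induction_on with
  | C c => simp
  | add p q hp hq =>
    rw [map_add, add_sub_add_comm]
    exact add_mem hp hq
  | mul_X p i hp =>
    rw [map_mul, aeval_X]
    set φ := aeval (R := k) (fun i => if i ∈ T then C (a i) else (X i : MvPolynomial σ k)) p
    by_cases hi : i ∈ T
    · rw [if_pos hi, show p * X i - φ * C (a i) = p * (X i - C (a i)) + C (a i) * (p - φ) by ring]
      exact add_mem (Ideal.mul_mem_left _ _ (Ideal.subset_span ⟨i, hi, rfl⟩))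
        (Ideal.mul_mem_left _ _ hp)
    · rw [if_neg hi, ← sub_mul]
      exact Ideal.mul_mem_right _ _ hp

/-- Modulo the earlier terms, the ring is the polynomial ring in the remaining variables, a domain
in which `X i - a i` is nonzero. The quotient is detected by substitution. -/
lemma isWeaklyRegular_X_sub_C (a : σ → k) (l : List σ) (hl : l.Nodup) :
    IsWeaklyRegular (MvPolynomial σ k) (l.map fun i => (X i - C (a i) : MvPolynomial σ k)) := by
  classical
  induction l using List.reverseRecOn with
  | nil => exact .nil _ _
  | append_singleton l i ih =>
    have hil : i ∉ l := by
      intro h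
      exact (List.nodup_append.mp hl).2.2 i h i (by simp) rfl
    rw [List.map_append, isWeaklyRegular_append_iff]
    refine ⟨ih (List.nodup_append.mp hl).1, ?_⟩
    rw [List.map_singleton, isWeaklyRegular_singleton_iff,
      isSMulRegular_quotient_iff_mem_of_smul_mem]
    have hI : (Ideal.ofList (l.map fun i => (X i - C (a i) : MvPolynomial σ k)) •
        (⊤ : Submodule (MvPolynomial σ k) (MvPolynomial σ k))) =
        Ideal.span ((fun i => (X i - C (a i) : MvPolynomial σ k)) '' {i | i ∈ l}) := by
      rw [smul_eq_mul, Ideal.mul_top, Ideal.ofList]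
      congr 1
      ext; simp
    rw [hI]
    intro f hf
    have h1 : ∀ g ∈ Ideal.span ((fun i => (X i - C (a i) : MvPolynomial σ k)) '' {i | i ∈ l}),
        aeval (fun i => if i ∈ {i | i ∈ l} then C (a i) else (X i : MvPolynomial σ k)) g = 0 := by
      intro g hg
      rw [← AlgHom.coe_toRingHom, ← RingHom.mem_ker]
      refine (Ideal.span_le.mpr ?_) hg
      rintro _ ⟨j, hj, rfl⟩
      rw [SetLike.mem_coe, RingHom.mem_ker, AlgHom.coe_toRingHom, map_sub, aeval_X, if_pos hj]
      simp
    have h2 := h1 _ hf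
    rw [smul_eq_mul, map_mul, map_sub, aeval_X, if_neg (by simpa using hil), aeval_C,
      mul_eq_zero] at h2
    have h3 : aeval (fun i => if i ∈ {i | i ∈ l} then C (a i) else (X i : MvPolynomial σ k)) f = 0 := by
      refine h2.resolve_left fun h => ?_
      have h0 : (0 : σ →₀ ℕ) ≠ Finsupp.single i 1 := (Finsupp.single_ne_zero.mpr one_ne_zero).symm
      have := congrArg (coeff (Finsupp.single i 1)) h
      simp [coeff_C, h0, algebraMap_eq] at this
    have h4 := sub_aeval_ite_mem a {i | i ∈ l} f
    rwa [h3, sub_zero] at h4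

lemma vanishingIdeal_singleton_eq_span (a : σ → k) :
    vanishingIdeal k {a} = Ideal.span (Set.range fun i => (X i - C (a i) : MvPolynomial σ k)) := by
  classical
  apply le_antisymm
  · intro f hf
    have h1 := sub_aeval_ite_mem a Set.univ f
    rw [mem_vanishingIdeal_singleton_iff] at hf
    have h2 : aeval (fun i => if i ∈ Set.univ then C (a i) else (X i : MvPolynomial σ k)) f =
        C (aeval a f) := by
      simp only [Set.mem_univ, if_true]
      rw [← algebraMap_eq, ← aeval_algebraMap_apply]
      rfl
    rwa [h2, hf, C_0, sub_zero, Set.image_univ] at h1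
  · rw [Ideal.span_le]
    rintro _ ⟨i, rfl⟩
    simp

variable (a : σ → k)

lemma maximalIdeal_atPoint (e : Fin (Fintype.card σ) ≃ σ) :
    maximalIdeal (Localization.AtPrime (vanishingIdeal k {a} : Ideal (MvPolynomial σ k))) =
      Ideal.span (Set.range fun i => algebraMap (MvPolynomial σ k) _ (X (e i) - C (a (e i)))) := by
  refine (Localization.AtPrime.map_eq_maximalIdeal).symm.trans
    ((congrArg (Ideal.map (algebraMap (MvPolynomial σ k) _))
      (vanishingIdeal_singleton_eq_span a)).trans ?_)
  rw [Ideal.map_span, ← Set.range_comp]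
  congr 1
  exact (e.surjective.range_comp _).symm

lemma ringKrullDim_atPoint_le :
    ringKrullDim (Localization.AtPrime (vanishingIdeal k {a} : Ideal (MvPolynomial σ k))) ≤
      (Fintype.card σ : ℕ) := by
  refine (ringKrullDim_le_spanFinrank_maximalIdeal _).trans ?_
  rw [maximalIdeal_atPoint a (Fintype.equivFin σ).symm]
  norm_cast
  refine (Submodule.spanFinrank_span_le_ncard_of_finite (Set.finite_range _)).trans ?_
  rw [← Set.image_univ]
  exact (Set.ncard_image_le Set.finite_univ).trans (by simp [Set.ncard_univ])

lemma hasDepthGE_atPoint :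
    HasDepthGE (Localization.AtPrime (vanishingIdeal k {a} : Ideal (MvPolynomial σ k)))
      (Localization.AtPrime (vanishingIdeal k {a} : Ideal (MvPolynomial σ k)))
      (Fintype.card σ) := by
  have h := isWeaklyRegular_X_sub_C a Finset.univ.toList (Finset.nodup_toList _)
  have hm : ∀ r ∈ Finset.univ.toList.map fun i => (X i - C (a i) : MvPolynomial σ k),
      r ∈ (vanishingIdeal k {a} : Ideal (MvPolynomial σ k)) := by
    intro r hr
    obtain ⟨i, -, rfl⟩ := List.mem_map.mp hr
    simp
  refine Or.inr ⟨_, ?_, ?_, h.isRegular_of_isLocalization_of_mem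
    (Localization.AtPrime (vanishingIdeal k {a})) (vanishingIdeal k {a}) hm⟩
  · simp
  · intro r hr
    obtain ⟨s, hs, rfl⟩ := List.mem_map.mp hr
    exact (IsLocalization.AtPrime.to_map_mem_maximal_iff _ (vanishingIdeal k {a}) s).mpr (hm s hs)

lemma card_le_height_add_ringKrullDim (P : Ideal (MvPolynomial σ k)) [P.IsPrime]
    (hP : P ≤ vanishingIdeal k {a}) :
    (Fintype.card σ : WithBot ℕ∞) ≤ P.height + ringKrullDim
      (Localization.AtPrime (vanishingIdeal k {a} : Ideal (MvPolynomial σ k)) ⧸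
        P.map (algebraMap _ (Localization.AtPrime (vanishingIdeal k {a})))) := by
  have hd : Disjoint ((vanishingIdeal k {a}).primeCompl : Set (MvPolynomial σ k)) (P : Set _) :=
    Set.disjoint_left.mpr fun x hx hxP => hx (hP hxP)
  have : (P.map (algebraMap _ (Localization.AtPrime (vanishingIdeal k {a})))).IsPrime :=
    IsLocalization.isPrime_of_isPrime_disjoint (vanishingIdeal k {a}).primeCompl _ P ‹_› hd
  rw [← IsLocalization.height_map_of_disjoint (S := Localization.AtPrime (vanishingIdeal k {a}))
    (vanishingIdeal k {a}).primeCompl P hd]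
  exact (hasDepthGE_atPoint a).natCast_le_height_add_ringKrullDim (ringKrullDim_atPoint_le a) _

/-- By the Nullstellensatz `P` lies in the ideal of a point, whose local ring is Cohen–Macaulay with
the coordinates as regular sequence. Localizing that ring further at `P` gives the local ring at
`P`. -/
lemma hasDepthGE_atPrime [IsAlgClosed k] (P : Ideal (MvPolynomial σ k)) [P.IsPrime] {r : ℕ}
    (hr : (r : ℕ∞) ≤ P.height) : HasDepthGE (Localization.AtPrime P) (Localization.AtPrime P) r := by
  obtain ⟨𝔪, h𝔪, hle⟩ := P.exists_le_maximal (Ideal.IsPrime.ne_top ‹_›)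
  obtain ⟨a, rfl⟩ := isMaximal_iff_eq_vanishingIdeal_singleton.mp h𝔪
  have hd : Disjoint ((vanishingIdeal k {a}).primeCompl : Set (MvPolynomial σ k)) (P : Set _) :=
    Set.disjoint_left.mpr fun x hx hxP => hx (hle hxP)
  let P' := P.map (algebraMap _ (Localization.AtPrime (vanishingIdeal k {a})))
  have : P'.IsPrime :=
    IsLocalization.isPrime_of_isPrime_disjoint (vanishingIdeal k {a}).primeCompl _ P ‹_› hd
  rw [← IsLocalization.height_map_of_disjoint (S := Localization.AtPrime (vanishingIdeal k {a}))
    (vanishingIdeal k {a}).primeCompl P hd] at hr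
  have h := (hasDepthGE_atPoint a).localization (ringKrullDim_atPoint_le a) P' hr
  have hloc := IsLocalization.isLocalization_isLocalization_atPrime_isLocalization
    (M := (vanishingIdeal k {a}).primeCompl) (Localization.AtPrime P') P'
  simp_rw [P', IsLocalization.under_map_of_isPrime_disjoint _ _ _ hd] at hloc
  exact h.of_ringEquiv (IsLocalization.algEquiv P.primeCompl (Localization.AtPrime P')
    (Localization.AtPrime P)).toRingEquiv

end MvPolynomial

end

/-! ### Positivity of the grading on the Cox ring -/

namespace SmoothProjectiveFan

variable {d : ℕ} {R : Type*} [Fintype R] [DecidableEq R] (X : SmoothProjectiveFan d R)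
  (k : Type*) [Field k]

/-- The degree of a divisor class against a curve class that is positive on all `D_ρ`. -/
lemma exists_weight : ∃ w : X.Pic →+ ℝ, ∀ ρ, 0 < w (X.divClass ρ) := by
  -- By completeness the negative of the sum of all rays lies in some cone. Rearranging gives a
  -- relation among the rays with all coefficients `t ρ ≥ 1`; pairing divisors with `t` kills the
  -- principal ones.
  obtain ⟨σ, -, c, hc, hu⟩ := X.complete (fun i => -∑ ρ, (X.ray ρ i : ℝ))
  let t : R → ℝ := fun ρ => 1 + if ρ ∈ σ then c ρ else 0
  have ht : ∀ i, ∑ ρ, t ρ * (X.ray ρ i : ℝ) = 0 := by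
    intro i
    have := congrFun hu i
    simp only [Finset.sum_apply, Pi.smul_apply, smul_eq_mul] at this
    simp only [t, add_mul, one_mul, Finset.sum_add_distrib, ite_mul, zero_mul,
      Finset.sum_ite_mem, Finset.univ_inter]
    rw [← this]
    ring
  let f : (R → ℤ) →+ ℝ :=
    { toFun := fun a => ∑ ρ, t ρ * (a ρ : ℝ)
      map_zero' := by simp
      map_add' := fun a b => by simp [mul_add, Finset.sum_add_distrib] }
  have hf : ∀ a ∈ X.divHom.range, f a = 0 := by
    rintro _ ⟨m, rfl⟩
    change ∑ ρ, t ρ * ((∑ i, m i * X.ray ρ i : ℤ) : ℝ) = 0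
    push_cast
    simp_rw [Finset.mul_sum]
    rw [Finset.sum_comm]
    refine Finset.sum_eq_zero fun i _ => ?_
    rw [← mul_zero (m i : ℝ), ← ht i, Finset.mul_sum]
    exact Finset.sum_congr rfl fun ρ _ => by ring
  refine ⟨QuotientAddGroup.lift X.divHom.range f hf, fun ρ => ?_⟩
  change 0 < f (Pi.single ρ 1)
  have : f (Pi.single ρ 1) = t ρ := by
    change ∑ ρ', t ρ' * ((Pi.single ρ (1 : ℤ) : R → ℤ) ρ' : ℝ) = t ρ
    rw [Finset.sum_eq_single ρ]
    · simp
    · intro b _ hb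
      simp [hb]
    · simp
  rw [this]
  have := hc ρ
  simp only [t]
  split_ifs <;> linarith

lemma weight_pos {w : X.Pic →+ ℝ} (hw : ∀ ρ, 0 < w (X.divClass ρ)) {e : R →₀ ℕ} (he : e ≠ 0) :
    0 < w (Finsupp.weight X.divClass e) := by
  rw [Finsupp.weight_apply, Finsupp.sum, map_sum]
  refine Finset.sum_pos (fun ρ hρ => ?_) (Finsupp.support_nonempty_iff.mpr he)
  rw [map_nsmul]
  exact nsmul_pos (hw ρ) (Finsupp.mem_support_iff.mp hρ)

variable {k} in
/-- A homogeneous polynomial with nonzero constant term is constant. -/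
lemma eq_C_of_coeff_zero_ne_zero {α : X.Pic} {f : X.Cox k} (hf : f ∈ X.coxGrading k α)
    (h0 : MvPolynomial.coeff 0 f ≠ 0) : f = MvPolynomial.C (MvPolynomial.coeff 0 f) := by
  obtain ⟨w, hw⟩ := X.exists_weight
  ext e
  rw [MvPolynomial.coeff_C]
  split_ifs with h
  · rw [h]
  · by_contra he
    have h1 := hf he
    have h2 := hf h0
    have h3 := X.weight_pos hw (Ne.symm h)
    rw [h1, ← h2, map_zero, map_zero] at h3
    exact lt_irrefl _ h3

lemma monomial_mem (e : R →₀ ℕ) (c : k) :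
    (MvPolynomial.monomial e c : X.Cox k) ∈ X.coxGrading k (Finsupp.weight X.divClass e) :=
  MvPolynomial.isWeightedHomogeneous_monomial _ _ _ rfl

section GradedModule

variable {k} {M : Type*} [AddCommGroup M] [Module (X.Cox k) M] (ℳ : X.Pic → AddSubgroup M)
  [SetLike.GradedSMul (X.coxGrading k) ℳ] [DirectSum.Decomposition ℳ]

open DirectSum in
/-- A polynomial with nonzero constant term is a nonzerodivisor on every graded module. -/
lemma eq_zero_of_smul_eq_zero (ℳ : X.Pic → AddSubgroup M)
    [SetLike.GradedSMul (X.coxGrading k) ℳ] [Decomposition ℳ] {f : X.Cox k} (hf : MvPolynomial.coeff 0 f ≠ 0) {y : M}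
    (hy : f • y = 0) : y = 0 := by
  classical
  obtain ⟨w, hw⟩ := X.exists_weight
  by_contra hy0
  have hne : (decompose ℳ y).support.Nonempty := by
    rw [Finset.nonempty_iff_ne_empty, Ne, DFinsupp.support_eq_empty]
    exact fun h => hy0 ((decompose ℳ).injective (by rw [h, decompose_zero]))
  obtain ⟨α, hα, hmin⟩ := Finset.exists_min_image _ w hne
  have h1 : f • y = ∑ e ∈ f.support, ∑ γ ∈ (decompose ℳ y).support,
      (MvPolynomial.monomial e (MvPolynomial.coeff e f) : X.Cox k) • (decompose ℳ y γ : M) := by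
    conv_lhs => rw [f.as_sum, ← sum_support_decompose ℳ y, Finset.sum_smul]
    simp_rw [Finset.smul_sum]
  -- Nonconstant monomials strictly raise the weight and `α` has least weight in `y`, so only the
  -- constant term of `f` reaches degree `α`.
  have h2 : (decompose ℳ (f • y) α : M) =
      (MvPolynomial.monomial 0 (MvPolynomial.coeff 0 f) : X.Cox k) • (decompose ℳ y α : M) := by
    have hmem : ∀ e γ, (MvPolynomial.monomial e (MvPolynomial.coeff e f) : X.Cox k) •
        (decompose ℳ y γ : M) ∈ ℳ (Finsupp.weight X.divClass e + γ) := fun e γ =>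
      X.smul_mem_graded k ℳ rfl (X.monomial_mem k e _) (SetLike.coe_mem _)
    let π : M →+ M :=
      { toFun := fun z => (decompose ℳ z α : M)
        map_zero' := by simp
        map_add' := fun a b => by simp [decompose_add] }
    change π (f • y) = _
    simp_rw [h1, map_sum]
    rw [Finset.sum_eq_single 0, Finset.sum_eq_single α]
    · have := hmem 0 α
      rw [map_zero, zero_add] at this
      exact decompose_of_mem_same ℳ this
    · intro γ _ hγ
      have := hmem 0 γ
      rw [map_zero, zero_add] at this
      exact decompose_of_mem_ne ℳ this hγ
    · intro h; exact absurd hα h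
    · intro e _ he
      refine Finset.sum_eq_zero fun γ hγ => decompose_of_mem_ne ℳ (hmem e γ) fun h => ?_
      have h3 := X.weight_pos hw he
      have h4 := hmin γ hγ
      rw [← h, map_add] at h4
      linarith
    · intro h
      exact absurd (MvPolynomial.mem_support_iff.mpr hf) h
  rw [hy, decompose_zero, DFinsupp.zero_apply, AddSubgroup.coe_zero] at h2
  have h3 : (MvPolynomial.monomial 0 (MvPolynomial.coeff 0 f)⁻¹ : X.Cox k) •
      (MvPolynomial.monomial 0 (MvPolynomial.coeff 0 f) : X.Cox k) • (decompose ℳ y α : M) = 0 := by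
    rw [← h2, smul_zero]
  rw [smul_smul, MvPolynomial.monomial_mul, inv_mul_cancel₀ hf, add_zero] at h3
  rw [DFinsupp.mem_support_iff] at hα
  apply hα
  ext
  rw [← one_smul (X.Cox k) (decompose ℳ y α : M)]
  exact h3

variable {N : Type*} [AddCommGroup N] [Module (X.Cox k) N] (𝒩 : X.Pic → AddSubgroup N)
  [DirectSum.Decomposition 𝒩]

-- The shift `δ` accommodates lifts of sheaf morphisms, which are module maps only after
-- multiplication by a power of `coneMonomial σ`.
open DirectSum in
lemma decompose_map (f : M →ₗ[X.Cox k] N) (δ : X.Pic) (hf : ∀ α, ∀ m ∈ ℳ α, f m ∈ 𝒩 (α + δ))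
    (x : M) (α : X.Pic) : (decompose 𝒩 (f x) (α + δ) : N) = f (decompose ℳ x α) := by
  induction x using Decomposition.inductionOn ℳ with
  | zero => simp
  | @homogeneous i m =>
    by_cases h : i = α
    · subst h
      rw [decompose_of_mem_same 𝒩 (hf _ _ m.2), decompose_of_mem_same ℳ m.2]
    · rw [decompose_of_mem_ne 𝒩 (hf _ _ m.2) (fun h' => h (add_right_cancel h')),
        decompose_of_mem_ne ℳ m.2 h, map_zero]
  | add m m' h h' => simp [decompose_add, h, h']

open DirectSum in
lemma exists_mem_of_map_mem (f : M →ₗ[X.Cox k] N) (hf : ∀ α, ∀ m ∈ ℳ α, f m ∈ 𝒩 α)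
    {α : X.Pic} {x : M} (hx : f x ∈ 𝒩 α) : ∃ y ∈ ℳ α, f y = f x := by
  refine ⟨decompose ℳ x α, SetLike.coe_mem _, ?_⟩
  rw [← decompose_map X ℳ 𝒩 f 0 (by simpa using hf), add_zero, decompose_of_mem_same 𝒩 hx]

end GradedModule

open DirectSum in
noncomputable instance freeGradingDecomposition {b : ℕ} (a : Fin b → X.Pic) :
    Decomposition (X.freeGrading k a) := by
  classical
  letI : Decomposition (X.coxGrading k) := MvPolynomial.weightedDecomposition k X.divClass
  let ι : ∀ (j : Fin b) (β : X.Pic), X.coxGrading k β →+ X.freeGrading k a (β + a j) := fun j β =>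
    { toFun := fun s => ⟨Pi.single j (s : X.Cox k), fun l => by
        by_cases h : l = j
        · subst h
          simp
        · simp [h]⟩
      map_zero' := by ext; simp
      map_add' := fun s t => by ext1; simp [Pi.single_add] }
  let T : ∀ j : Fin b, (⨁ β, X.coxGrading k β) →+ ⨁ α, X.freeGrading k a α := fun j =>
    toAddMonoid fun β => (of (fun α => X.freeGrading k a α) (β + a j)).comp (ι j β)
  let D : (Fin b → X.Cox k) →+ ⨁ α, X.freeGrading k a α :=
    ∑ j, (T j).comp ((decomposeAddEquiv (X.coxGrading k)).toAddMonoidHom.comp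
      (Pi.evalAddMonoidHom (fun _ => X.Cox k) j))
  have hT : ∀ j β (s : X.Cox k) (hs : s ∈ X.coxGrading k β), T j (decompose (X.coxGrading k) s) =
      of (fun α => X.freeGrading k a α) (β + a j) (ι j β ⟨s, hs⟩) := by
    intro j β s hs
    rw [decompose_of_mem _ hs]
    simp [T]
  have hD : ∀ x, D x = ∑ j, T j (decompose (X.coxGrading k) (x j)) := fun x => by
    simp [D]
  refine Decomposition.ofAddHom _ D ?_ ?_
  · refine AddMonoidHom.ext fun x => ?_
    rw [AddMonoidHom.comp_apply, hD, map_sum, AddMonoidHom.id_apply]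
    have : ∀ j (s : X.Cox k), DirectSum.coeAddMonoidHom (X.freeGrading k a)
        (T j (decompose (X.coxGrading k) s)) = (Pi.single j s : Fin b → X.Cox k) := by
      intro j s
      induction s using Decomposition.inductionOn (X.coxGrading k) with
      | zero => simp
      | @homogeneous β s =>
        rw [hT j β s s.2, coeAddMonoidHom_of]
        rfl
      | add s t hs ht => rw [decompose_add, map_add, map_add, hs, ht, Pi.single_add]
    simp_rw [this]
    exact Finset.univ_sum_single x
  · ext α x : 2
    rw [AddMonoidHom.comp_apply, AddMonoidHom.comp_apply, coeAddMonoidHom_of, hD,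
      AddMonoidHom.id_comp]
    have : ∀ j, T j (decompose (X.coxGrading k) ((x : Fin b → X.Cox k) j)) =
        of (fun α => X.freeGrading k a α) α ⟨Pi.single j ((x : Fin b → X.Cox k) j), fun l => by
          by_cases h : l = j
          · subst h
            simpa using x.2 l
          · simp [h]⟩ := by
      intro j
      rw [hT j _ _ (x.2 j)]
      have hof : ∀ β (_ : β = α) z (h1 : z ∈ X.freeGrading k a β) (h2 : z ∈ X.freeGrading k a α),
          of (fun α => X.freeGrading k a α) β ⟨z, h1⟩ =
            of (fun α => X.freeGrading k a α) α ⟨z, h2⟩ := by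
        rintro β rfl z h1 h2
        rfl
      exact hof _ (sub_add_cancel α (a j)) _ _ _
    simp_rw [this, ← map_sum]
    congr 1
    ext1
    rw [AddSubgroup.val_finsetSum]
    exact Finset.univ_sum_single _

end SmoothProjectiveFan

/-! ### Exactness after localization -/

lemma LocalizedModule.mk_finset_sum {A : Type*} [CommRing A] (T : Submonoid A) {M : Type*}
    [AddCommGroup M] [Module A M] {ι : Type*} (s : Finset ι) (f : ι → M) (t : T) :
    LocalizedModule.mk (∑ i ∈ s, f i) t = ∑ i ∈ s, LocalizedModule.mk (f i) t := by
  classical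
  induction s using Finset.induction_on with
  | empty => simp
  | insert i s hi ih => rw [Finset.sum_insert hi, Finset.sum_insert hi, ← ih,
      LocalizedModule.mk_add_mk, ← smul_add, LocalizedModule.mk_cancel_common_left]

lemma LocalizedModule.mk_eq_zero_iff_exists {A : Type*} [CommRing A] {T : Submonoid A} {M : Type*}
    [AddCommGroup M] [Module A M] {m : M} {t : T} :
    LocalizedModule.mk m t = 0 ↔ ∃ s ∈ T, s • m = 0 := by
  rw [← LocalizedModule.zero_mk t, LocalizedModule.mk_eq]
  constructor
  · rintro ⟨u, hu⟩
    refine ⟨u * t, mul_mem u.2 t.2, ?_⟩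
    rw [mul_smul]
    simpa [Submonoid.smul_def] using hu
  · rintro ⟨s, hs, h⟩
    refine ⟨⟨s, hs⟩, ?_⟩
    rw [smul_comm]
    simp [Submonoid.smul_def, h]

/-- Exactness is required only up to multipliers in `T`, which is what a chart provides once
denominators are cleared. -/
lemma LocalizedModule.exact_map_of_forall {A : Type*} [CommRing A] (T : Submonoid A)
    {M N Q : Type*} [AddCommGroup M] [Module A M] [AddCommGroup N] [Module A N] [AddCommGroup Q]
    [Module A Q] (f : M →ₗ[A] N) (g : N →ₗ[A] Q) (h1 : ∀ x, ∃ s ∈ T, s • g (f x) = 0)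
    (h2 : ∀ y, g y = 0 → ∃ s ∈ T, s • y ∈ LinearMap.range f) :
    Function.Exact (LocalizedModule.map T f) (LocalizedModule.map T g) := by
  intro y
  induction y using LocalizedModule.induction_on with
  | h y t =>
  constructor
  · intro h
    rw [LocalizedModule.map_mk, LocalizedModule.mk_eq_zero_iff_exists] at h
    obtain ⟨s, hs, hsy⟩ := h
    rw [← map_smul] at hsy
    obtain ⟨s', hs', x, hx⟩ := h2 _ hsy
    refine ⟨LocalizedModule.mk x (⟨s', hs'⟩ * ⟨s, hs⟩ * t), ?_⟩
    rw [LocalizedModule.map_mk, hx, smul_smul]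
    exact LocalizedModule.mk_cancel_common_left (⟨s', hs'⟩ * ⟨s, hs⟩) t y
  · rintro ⟨x, hx⟩
    rw [← hx]
    induction x using LocalizedModule.induction_on with
    | h x t =>
    rw [LocalizedModule.map_mk, LocalizedModule.map_mk, LocalizedModule.mk_eq_zero_iff_exists]
    obtain ⟨s, hs, h⟩ := h1 x
    exact ⟨s, hs, h⟩

lemma LocalizedModule.map_surjective_of_forall {A : Type*} [CommRing A] (T : Submonoid A)
    {M N : Type*} [AddCommGroup M] [Module A M] [AddCommGroup N] [Module A N]
    (f : M →ₗ[A] N) (h : ∀ y, ∃ s ∈ T, s • y ∈ LinearMap.range f) :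
    Function.Surjective (LocalizedModule.map T f) := by
  intro y
  induction y using LocalizedModule.induction_on with
  | h y t =>
  obtain ⟨s, hs, x, hx⟩ := h y
  refine ⟨LocalizedModule.mk x (⟨s, hs⟩ * t), ?_⟩
  rw [LocalizedModule.map_mk, hx]
  exact LocalizedModule.mk_cancel_common_left ⟨s, hs⟩ t y

/-! ### Degrees and sections on a chart -/

namespace SmoothProjectiveFan

variable {d : ℕ} {R : Type*} [Fintype R] [DecidableEq R] (X : SmoothProjectiveFan d R)
  (k : Type*) [Field k]

/-- The rays of `σ` are part of a lattice basis, so some character has any prescribed pairings with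
them; subtracting its divisor removes the coefficients along `σ`. -/
lemma exists_eq_sum_divClass {σ : Finset R} (hσ : σ ∈ X.cones) (α : X.Pic) :
    ∃ a : R → ℤ, α = ∑ ρ ∈ σᶜ, a ρ • X.divClass ρ := by
  obtain ⟨bb, j, hj⟩ := X.smooth σ hσ
  obtain ⟨b, rfl⟩ := QuotientAddGroup.mk'_surjective X.divHom.range α
  let L : (Fin d → ℤ) →ₗ[ℤ] ℤ := ∑ ρ : σ, b ρ • bb.coord (j ρ)
  have hL : ∀ ρ : σ, L (X.ray ρ) = b ρ := by
    intro ρ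
    simp only [L, LinearMap.sum_apply, LinearMap.smul_apply, ← hj ρ, Module.Basis.coord_apply,
      Module.Basis.repr_self, smul_eq_mul]
    rw [Finset.sum_eq_single ρ]
    · simp
    · intro ρ' _ h
      rw [Finsupp.single_eq_of_ne (fun h' => h (j.injective h')), mul_zero]
    · simp
  let m : Fin d → ℤ := fun i => L (Pi.single i 1)
  have hm : ∀ v : Fin d → ℤ, L v = ∑ i, m i * v i := by
    intro v
    conv_lhs => rw [← Finset.univ_sum_single v]
    rw [map_sum]
    refine Finset.sum_congr rfl fun i _ => ?_
    rw [show (Pi.single i (v i) : Fin d → ℤ) = v i • Pi.single i 1 by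
      rw [← Pi.single_smul, smul_eq_mul, mul_one], map_smul, smul_eq_mul, mul_comm]
  let a : R → ℤ := b - X.divHom m
  have ha : ∀ ρ ∈ σ, a ρ = 0 := by
    intro ρ hρ
    change b ρ - ∑ i, m i * X.ray ρ i = 0
    rw [← hm, hL ⟨ρ, hρ⟩, sub_self]
  refine ⟨a, ?_⟩
  have h1 : QuotientAddGroup.mk' X.divHom.range b = QuotientAddGroup.mk' X.divHom.range a := by
    rw [map_sub, (QuotientAddGroup.eq_zero_iff (X.divHom m)).mpr ⟨m, rfl⟩ |> fun h =>
      (show QuotientAddGroup.mk' X.divHom.range (X.divHom m) = 0 from h), sub_zero]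
  have h2 : a = ∑ ρ, a ρ • (Pi.single ρ (1 : ℤ) : R → ℤ) := by
    conv_lhs => rw [← Finset.univ_sum_single a]
    refine Finset.sum_congr rfl fun ρ _ => ?_
    rw [← Pi.single_smul, smul_eq_mul, mul_one]
  have h3 : QuotientAddGroup.mk' X.divHom.range a = ∑ ρ, a ρ • X.divClass ρ := by
    conv_lhs => rw [h2]
    rw [map_sum]
    refine Finset.sum_congr rfl fun ρ _ => ?_
    rw [map_zsmul]
    rfl
  refine (h1.trans h3).trans ?_
  symm
  apply Finset.sum_subset (Finset.subset_univ _)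
  intro ρ _ hρ
  rw [ha ρ (by simpa using hρ)]
  exact zero_zsmul _

/-- Every degree is the degree of a unit of the localization at `coneMonomial σ`. -/
lemma exists_mul_eq_coneMonomial_pow {σ : Finset R} (hσ : σ ∈ X.cones) (α : X.Pic) :
    ∃ (N : ℕ) (p q : X.Cox k), p ∈ X.coxGrading k (N • X.coneDeg σ - α) ∧
      q ∈ X.coxGrading k (N • X.coneDeg σ + α) ∧ p * q = X.coneMonomial k σ ^ (N + N) := by
  obtain ⟨a, rfl⟩ := X.exists_eq_sum_divClass hσ α
  -- `N` bounds every `|a ρ|`, so the exponents `N - a ρ` of `p` and `N + a ρ` of `q` are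
  -- nonnegative and add up to `2N`.
  let N : ℕ := ∑ ρ, (a ρ).natAbs
  have hN : ∀ ρ, |a ρ| ≤ N := by
    intro ρ
    rw [Int.abs_eq_natAbs]
    exact_mod_cast Finset.single_le_sum (f := fun ρ => (a ρ).natAbs) (fun _ _ => Nat.zero_le _)
      (Finset.mem_univ ρ)
  have hdeg : ∀ e : R → ℕ, (∏ ρ ∈ σᶜ, MvPolynomial.X ρ ^ e ρ : X.Cox k) ∈
      X.coxGrading k (∑ ρ ∈ σᶜ, e ρ • X.divClass ρ) := fun e =>
    SetLike.prod_mem_graded _ _ _ fun ρ _ => SetLike.pow_mem_graded _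
      (MvPolynomial.isWeightedHomogeneous_X k X.divClass ρ)
  have h1 : ∀ ρ, ((N - a ρ).toNat : ℤ) = N - a ρ := fun ρ =>
    Int.toNat_of_nonneg (by have := le_abs_self (a ρ); have := hN ρ; omega)
  have h2 : ∀ ρ, ((N + a ρ).toNat : ℤ) = N + a ρ := fun ρ =>
    Int.toNat_of_nonneg (by have := neg_abs_le (a ρ); have := hN ρ; omega)
  refine ⟨N, ∏ ρ ∈ σᶜ, MvPolynomial.X ρ ^ (N - a ρ).toNat,
    ∏ ρ ∈ σᶜ, MvPolynomial.X ρ ^ (N + a ρ).toNat, ?_, ?_, ?_⟩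
  · convert hdeg _ using 2
    rw [coneDeg, Finset.smul_sum, ← Finset.sum_sub_distrib]
    refine Finset.sum_congr rfl fun ρ _ => ?_
    rw [← natCast_zsmul, ← natCast_zsmul, h1, sub_zsmul, sub_eq_add_neg]
  · convert hdeg _ using 2
    rw [coneDeg, Finset.smul_sum, ← Finset.sum_add_distrib]
    refine Finset.sum_congr rfl fun ρ _ => ?_
    rw [← natCast_zsmul, ← natCast_zsmul, h2, add_zsmul]
  · rw [← Finset.prod_mul_distrib, coneMonomial, ← Finset.prod_pow]
    refine Finset.prod_congr rfl fun ρ _ => ?_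
    rw [← pow_add]
    congr 1
    have := h1 ρ
    have := h2 ρ
    omega

variable {k}

section Relevant

variable {T : Submonoid (X.Cox k)}

open DirectSum in
lemma exists_smul_mem_of_homogeneous {M : Type*} [AddCommGroup M] [Module (X.Cox k) M]
    (ℳ : X.Pic → AddSubgroup M) [Decomposition ℳ] (K : Submodule (X.Cox k) M) (y : M)
    (h : ∀ α, ∃ s ∈ T, s • (decompose ℳ y α : M) ∈ K) : ∃ s ∈ T, s • y ∈ K := by
  classical
  choose s hs hK using h
  refine ⟨∏ α ∈ (decompose ℳ y).support, s α, prod_mem fun α _ => hs α, ?_⟩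
  have hy : y = ∑ α ∈ (decompose ℳ y).support, (decompose ℳ y α : M) :=
    (sum_support_decompose ℳ y).symm
  generalize (decompose ℳ y).support = S at *
  rw [hy, Finset.smul_sum]
  refine Submodule.sum_mem _ fun α hα => ?_
  rw [← Finset.mul_prod_erase S s hα, mul_comm, mul_smul]
  exact Submodule.smul_mem _ _ (hK α)

variable (k)

variable {M : Type*} [AddCommGroup M] [Module (X.Cox k) M] (ℳ : X.Pic → AddSubgroup M)
  [SetLike.GradedSMul (X.coxGrading k) ℳ]
  {N : Type*} [AddCommGroup N] [Module (X.Cox k) N] (𝒩 : X.Pic → AddSubgroup N)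
  [SetLike.GradedSMul (X.coxGrading k) 𝒩]

/-- The section `m / (coneMonomial σ)^n`. -/
noncomputable def mkSection (σ : Finset R) (n : ℕ) (m : M) (hm : m ∈ ℳ (n • X.coneDeg σ)) :
    X.sections k ℳ σ := ⟨LocalizedModule.mk m (X.conePow k σ n), n, m, hm, rfl⟩

lemma exists_eq_mkSection {σ : Finset R} (z : X.sections k ℳ σ) :
    ∃ n m hm, z = X.mkSection k ℳ σ n m hm := by
  obtain ⟨_, n, m, hm, rfl⟩ := z
  exact ⟨n, m, hm, rfl⟩

lemma sectionsMap_mkSection (f : M →ₗ[X.Cox k] N) (hf : ∀ α, ∀ m ∈ ℳ α, f m ∈ 𝒩 α)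
    (σ : Finset R) (n : ℕ) (m : M) (hm : m ∈ ℳ (n • X.coneDeg σ)) :
    X.sectionsMap k ℳ 𝒩 f hf σ (X.mkSection k ℳ σ n m hm) = X.mkSection k 𝒩 σ n (f m) (hf _ _ hm) := by
  ext1
  exact LocalizedModule.map_mk (S := X.coneSub k σ) f m (X.conePow k σ n)

lemma mkSection_eq_iff {σ : Finset R} {n n' : ℕ} {m m' : M} (hm : m ∈ ℳ (n • X.coneDeg σ))
    (hm' : m' ∈ ℳ (n' • X.coneDeg σ)) :
    X.mkSection k ℳ σ n m hm = X.mkSection k ℳ σ n' m' hm' ↔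
      ∃ t : ℕ, X.coneMonomial k σ ^ t • X.coneMonomial k σ ^ n' • m =
        X.coneMonomial k σ ^ t • X.coneMonomial k σ ^ n • m' := by
  rw [Subtype.ext_iff]
  refine LocalizedModule.mk_eq.trans ?_
  constructor
  · rintro ⟨⟨_, t, rfl⟩, h⟩
    exact ⟨t, h⟩
  · rintro ⟨t, h⟩
    exact ⟨⟨_, t, rfl⟩, h⟩

lemma mkSection_eq_zero_iff {σ : Finset R} {n : ℕ} {m : M} (hm : m ∈ ℳ (n • X.coneDeg σ)) :
    X.mkSection k ℳ σ n m hm = 0 ↔ ∃ t : ℕ, X.coneMonomial k σ ^ t • m = 0 := by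
  rw [Subtype.ext_iff]
  refine LocalizedModule.mk_eq_zero_iff_exists.trans ?_
  constructor
  · rintro ⟨_, ⟨t, rfl⟩, h⟩
    exact ⟨t, h⟩
  · rintro ⟨t, h⟩
    exact ⟨_, ⟨t, rfl⟩, h⟩

end Relevant

end SmoothProjectiveFan

namespace SmoothProjectiveFan

variable {d : ℕ} {R : Type*} [Fintype R] [DecidableEq R] (X : SmoothProjectiveFan d R)
  (k : Type*) [Field k]

section Relevant

variable {T : Submonoid (X.Cox k)} (hT : ∀ p q, p * q ∈ T → p ∈ T) {σ : Finset R}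
  (hσ : σ ∈ X.cones) (hc : X.coneMonomial k σ ∈ T)

-- `hT` makes `T` closed under divisors, as the complement of a prime is. Multiplication by `p`
-- moves degree `α` to a multiple of `coneDeg σ`, where elements define sections, and becomes
-- invertible over `T`.
include hT hσ hc in
lemma exists_mem_submonoid (α : X.Pic) :
    ∃ (N : ℕ) (p : X.Cox k), p ∈ X.coxGrading k (N • X.coneDeg σ - α) ∧ p ∈ T := by
  obtain ⟨N, p, q, hp, -, hpq⟩ := X.exists_mul_eq_coneMonomial_pow k hσ α
  exact ⟨N, p, hp, hT p q (hpq ▸ pow_mem hc _)⟩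

variable {M : Type*} [AddCommGroup M] [Module (X.Cox k) M] (ℳ : X.Pic → AddSubgroup M)
  [SetLike.GradedSMul (X.coxGrading k) ℳ]
  {N : Type*} [AddCommGroup N] [Module (X.Cox k) N] (𝒩 : X.Pic → AddSubgroup N)
  [SetLike.GradedSMul (X.coxGrading k) 𝒩] [DirectSum.Decomposition 𝒩]
  {Q : Type*} [AddCommGroup Q] [Module (X.Cox k) Q] (𝒬 : X.Pic → AddSubgroup Q)
  [SetLike.GradedSMul (X.coxGrading k) 𝒬] [DirectSum.Decomposition 𝒬]

-- Each homogeneous component of `y` becomes a section after multiplication by a `p ∈ T`; exactness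
-- lifts that section, and clearing denominators costs only elements of `T`.
include hT hσ hc in
open DirectSum in
lemma exists_smul_mem_range_of_exact_sections (f : M →ₗ[X.Cox k] N)
    (hf : ∀ α, ∀ m ∈ ℳ α, f m ∈ 𝒩 α) (g : N →ₗ[X.Cox k] Q) (hg : ∀ α, ∀ m ∈ 𝒩 α, g m ∈ 𝒬 α)
    (h : Function.Exact (X.sectionsMap k ℳ 𝒩 f hf σ) (X.sectionsMap k 𝒩 𝒬 g hg σ))
    {y : N} (hy : g y = 0) : ∃ s ∈ T, s • y ∈ LinearMap.range f := by
  refine X.exists_smul_mem_of_homogeneous 𝒩 _ y fun α => ?_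
  have hy' : g (decompose 𝒩 y α) = 0 := by
    rw [← decompose_map X 𝒩 𝒬 g 0 (by simpa using hg), hy]
    simp
  generalize hz : (decompose 𝒩 y α : N) = z at *
  have hzm : z ∈ 𝒩 α := hz ▸ SetLike.coe_mem _
  obtain ⟨n, p, hp, hpT⟩ := X.exists_mem_submonoid k hT hσ hc α
  have hpz : p • z ∈ 𝒩 (n • X.coneDeg σ) := X.smul_mem_graded k 𝒩 (by simp) hp hzm
  obtain ⟨w, hw⟩ := (h (X.mkSection k 𝒩 σ n (p • z) hpz)).mp (by
    rw [sectionsMap_mkSection, mkSection_eq_zero_iff]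
    exact ⟨0, by simp [hy']⟩)
  obtain ⟨n', x, hx, rfl⟩ := X.exists_eq_mkSection k ℳ w
  rw [sectionsMap_mkSection, mkSection_eq_iff] at hw
  obtain ⟨t, ht⟩ := hw
  refine ⟨X.coneMonomial k σ ^ t * (X.coneMonomial k σ ^ n' * p),
    mul_mem (pow_mem hc _) (mul_mem (pow_mem hc _) hpT), ?_⟩
  rw [mul_smul, mul_smul, ← ht]
  exact Submodule.smul_mem _ _ (Submodule.smul_mem _ _ ⟨x, rfl⟩)

/-- The element `a / (coneMonomial σ)^n` of the chart ring. -/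
noncomputable def mkChart (σ : Finset R) (n : ℕ) (a : X.Cox k)
    (ha : a ∈ X.coxGrading k (n • X.coneDeg σ)) : X.chartRing k σ :=
  ⟨Localization.mk a (X.conePow k σ n), n, a, ha, rfl⟩

lemma conePow_mul (σ : Finset R) (n m : ℕ) :
    X.conePow k σ n * X.conePow k σ m = X.conePow k σ (n + m) :=
  Subtype.ext (pow_add _ _ _).symm

set_option synthInstance.maxHeartbeats 400000 in
noncomputable instance sectionsSMul (σ : Finset R) : SMul (X.chartRing k σ) (X.sections k ℳ σ) :=
  (inferInstance : Module (X.chartRing k σ) (X.sections k ℳ σ)).toSMul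

lemma mkChart_smul_mkSection {σ : Finset R} {n n' : ℕ} {a : X.Cox k} {m : M}
    (ha : a ∈ X.coxGrading k (n • X.coneDeg σ)) (hm : m ∈ ℳ (n' • X.coneDeg σ)) :
    X.mkChart k σ n a ha • X.mkSection k ℳ σ n' m hm = X.mkSection k ℳ σ (n + n') (a • m)
      (X.smul_mem_graded k ℳ (by rw [add_smul]) ha hm) := by
  ext1
  change Localization.mk a (X.conePow k σ n) • LocalizedModule.mk m (X.conePow k σ n') =
    LocalizedModule.mk (a • m) (X.conePow k σ (n + n'))
  rw [LocalizedModule.mk_smul_mk, conePow_mul]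

lemma sum_mkSection {σ : Finset R} {ι : Type*} (s : Finset ι) (m : ι → M) {n : ℕ}
    (hm : ∀ i, m i ∈ ℳ (n • X.coneDeg σ)) :
    ∑ i ∈ s, X.mkSection k ℳ σ n (m i) (hm i) =
      X.mkSection k ℳ σ n (∑ i ∈ s, m i) (sum_mem fun i _ => hm i) := by
  ext1
  rw [Submodule.coe_sum]
  exact (LocalizedModule.mk_finset_sum _ _ _ _).symm

include hσ in
/-- A morphism of sheaves from a free module is locally induced by a homomorphism of modules. -/
lemma exists_linearMap_of_sections {b : ℕ} (a : Fin b → X.Pic)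
    (φ : X.sections k (X.freeGrading k a) σ →ₗ[X.chartRing k σ] X.sections k ℳ σ) :
    ∃ (K : ℕ) (η : (Fin b → X.Cox k) →ₗ[X.Cox k] M)
      (hη : ∀ α, ∀ x ∈ X.freeGrading k a α, η x ∈ ℳ (α + K • X.coneDeg σ)),
      ∀ n x hx, φ (X.mkSection k (X.freeGrading k a) σ n x hx) =
        X.mkSection k ℳ σ (n + K) (η x) (by rw [add_smul]; exact hη _ _ hx) := by
  choose n p q hp hq hpq using fun j => X.exists_mul_eq_coneMonomial_pow k hσ (a j)
  have he : ∀ j, p j • (Pi.single j 1 : Fin b → X.Cox k) ∈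
      X.freeGrading k a (n j • X.coneDeg σ) := by
    intro j l
    by_cases h : l = j
    · subst h
      simpa using hp l
    · simp [h]
  choose K m hm hK using fun j => X.exists_eq_mkSection k ℳ
    (φ (X.mkSection k (X.freeGrading k a) σ (n j) _ (he j)))
  let L : ℕ := ∑ j, (n j + K j)
  have hL : ∀ j, n j + K j ≤ L := fun j =>
    Finset.single_le_sum (f := fun j => n j + K j) (fun _ _ => Nat.zero_le _) (Finset.mem_univ j)
  -- Formally, with `c = coneMonomial σ`, the basis vector `e_j` is `(q j / c^(n j)) • (p j e_j /
  -- c^(n j))`. Hence `φ` sends it to `q j • m j / c^(n j + K j)`, and `v j` is the numerator over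
  -- the common denominator `c^L`.
  let v : Fin b → M := fun j => (X.coneMonomial k σ ^ (L - (n j + K j)) * q j) • m j
  have hv : ∀ j, v j ∈ ℳ (a j + L • X.coneDeg σ) := by
    intro j
    refine X.smul_mem_graded k ℳ ?_ (SetLike.mul_mem_graded
      (X.coneMonomial_pow_mem k σ (L - (n j + K j))) (hq j)) (hm j)
    have : L • X.coneDeg σ = (L - (n j + K j)) • X.coneDeg σ + n j • X.coneDeg σ +
        K j • X.coneDeg σ := by
      rw [← add_smul, ← add_smul]
      congr 1
      have := hL j
      omega
    rw [this]
    abel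
  let η : (Fin b → X.Cox k) →ₗ[X.Cox k] M := Fintype.linearCombination (X.Cox k) v
  have hηx : ∀ x, η x = ∑ j, x j • v j := fun x => Fintype.linearCombination_apply _ _ _
  refine ⟨L, η, ?_, ?_⟩
  · intro α x hx
    rw [hηx]
    exact sum_mem fun j _ => X.smul_mem_graded k ℳ (by abel) (hx j) (hv j)
  · intro N x hx
    have hc1 : ∀ j, x j * q j ∈ X.coxGrading k ((N + n j) • X.coneDeg σ) := by
      intro j
      have := SetLike.mul_mem_graded (hx j) (hq j)
      rwa [show N • X.coneDeg σ - a j + (n j • X.coneDeg σ + a j) = (N + n j) • X.coneDeg σ by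
        rw [add_smul]; abel] at this
    have h1 : X.mkSection k (X.freeGrading k a) σ N x hx =
        ∑ j, X.mkChart k σ (N + n j) (x j * q j) (hc1 j) •
          X.mkSection k (X.freeGrading k a) σ (n j) _ (he j) := by
      have h2 : ∀ j, (Pi.single j (x j) : Fin b → X.Cox k) ∈
          X.freeGrading k a (N • X.coneDeg σ) := by
        intro j l
        by_cases h : l = j
        · subst h
          simpa using hx l
        · simp [h]
      have h3 : ∀ j, X.mkChart k σ (N + n j) (x j * q j) (hc1 j) •
          X.mkSection k (X.freeGrading k a) σ (n j) _ (he j) =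
          X.mkSection k (X.freeGrading k a) σ N (Pi.single j (x j)) (h2 j) := by
        intro j
        rw [mkChart_smul_mkSection, mkSection_eq_iff]
        refine ⟨0, ?_⟩
        rw [show (Pi.single j (x j) : Fin b → X.Cox k) =
          x j • Pi.single j 1 by rw [← Pi.single_smul, smul_eq_mul, mul_one]]
        simp only [smul_smul]
        congr 1
        rw [add_assoc N, pow_add _ N, ← hpq j]
        ring
      simp_rw [h3]
      rw [sum_mkSection, mkSection_eq_iff]
      exact ⟨0, by rw [Finset.univ_sum_single]⟩
    have h4 : ∀ j, x j • v j ∈ ℳ ((N + L) • X.coneDeg σ) := fun j =>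
      X.smul_mem_graded k ℳ (by rw [add_smul]; abel) (hx j) (hv j)
    rw [h1, map_sum]
    have h5 : ∀ j, φ (X.mkChart k σ (N + n j) (x j * q j) (hc1 j) •
          X.mkSection k (X.freeGrading k a) σ (n j) _ (he j)) =
          X.mkSection k ℳ σ (N + L) (x j • v j) (h4 j) := by
      intro j
      rw [map_smul, hK j, mkChart_smul_mkSection, mkSection_eq_iff]
      refine ⟨0, ?_⟩
      simp only [v, smul_smul]
      congr 1
      have : X.coneMonomial k σ ^ (N + L) = X.coneMonomial k σ ^ (N + n j + K j) *
          X.coneMonomial k σ ^ (L - (n j + K j)) := by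
        rw [← pow_add]
        congr 1
        have := hL j
        omega
      rw [this]
      ring
    simp_rw [h5]
    rw [sum_mkSection, mkSection_eq_iff]
    exact ⟨0, by rw [hηx]⟩

end Relevant

end SmoothProjectiveFan

/-! ### Virtual resolutions at relevant primes -/

namespace SmoothProjectiveFan

variable {d : ℕ} {R : Type*} [Fintype R] [DecidableEq R] (X : SmoothProjectiveFan d R)
  (k : Type*) [Field k]
  {M : Type*} [AddCommGroup M] [Module (X.Cox k) M] (ℳ : X.Pic → AddSubgroup M)
  [SetLike.GradedSMul (X.coxGrading k) ℳ] [DirectSum.Decomposition ℳ]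

open DirectSum in
/-- At the relevant primes, a virtual resolution is a resolution. -/
lemma exists_augmentation {T : Submonoid (X.Cox k)} (hT : ∀ p q, p * q ∈ T → p ∈ T) {σ : Finset R}
    (hσ : σ ∈ X.cones) (hc : X.coneMonomial k σ ∈ T) (F : X.FreeComplex k)
    (hF : F.IsVirtualResolution ℳ) :
    ∃ η : (Fin (F.rank 0) → X.Cox k) →ₗ[X.Cox k] M,
      Function.Surjective (LocalizedModule.map T η) ∧
      Function.Exact (LocalizedModule.map T (F.diff 0)) (LocalizedModule.map T η) ∧
      ∀ i, Function.Exact (LocalizedModule.map T (F.diff (i + 1)))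
        (LocalizedModule.map T (F.diff i)) := by
  obtain ⟨ε, hε⟩ := hF
  obtain ⟨hsurj, hex0, hex⟩ := hε σ hσ
  -- On `U_σ`, `η` is `ε` times the `K`-th power of `coneMonomial σ`, which is a unit once `T` is
  -- inverted.
  obtain ⟨K, η, hη, hφ⟩ := X.exists_linearMap_of_sections k hσ ℳ (F.twist 0) (ε.app σ hσ)
  refine ⟨η, ?_, ?_, fun i => ?_⟩
  · refine LocalizedModule.map_surjective_of_forall T η fun y => ?_
    refine X.exists_smul_mem_of_homogeneous ℳ _ y fun α => ?_
    generalize hz : (decompose ℳ y α : M) = z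
    have hzm : z ∈ ℳ α := hz ▸ SetLike.coe_mem _
    obtain ⟨n, p, hp, hpT⟩ := X.exists_mem_submonoid k hT hσ hc α
    have hpz : p • z ∈ ℳ (n • X.coneDeg σ) := X.smul_mem_graded k ℳ (by simp) hp hzm
    obtain ⟨w, hw⟩ := hsurj (X.mkSection k ℳ σ n (p • z) hpz)
    obtain ⟨n', x, hx, rfl⟩ := X.exists_eq_mkSection k _ w
    rw [hφ, mkSection_eq_iff] at hw
    obtain ⟨t, ht⟩ := hw
    refine ⟨X.coneMonomial k σ ^ t * (X.coneMonomial k σ ^ (n' + K) * p),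
      mul_mem (pow_mem hc _) (mul_mem (pow_mem hc _) hpT), ?_⟩
    rw [mul_smul, mul_smul, ← ht]
    exact Submodule.smul_mem _ _ (Submodule.smul_mem _ _ ⟨x, rfl⟩)
  · refine LocalizedModule.exact_map_of_forall T _ _ (fun x => ?_) fun y hy => ?_
    -- The composite need not vanish on the nose, since `M` may have torsion invisible to the sheaf;
    -- it vanishes after multiplication by an element of `T`.
    · suffices ∃ s ∈ T, s • x ∈ LinearMap.ker (η ∘ₗ F.diff 0) by
        obtain ⟨s, hs, h⟩ := this
        refine ⟨s, hs, ?_⟩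
        rw [← map_smul, ← map_smul]
        exact h
      refine X.exists_smul_mem_of_homogeneous (F.grading 1) _ x fun α => ?_
      generalize hz : (decompose (F.grading 1) x α : Fin (F.rank 1) → X.Cox k) = z
      have hzm : z ∈ F.grading 1 α := hz ▸ SetLike.coe_mem _
      obtain ⟨n, p, hp, hpT⟩ := X.exists_mem_submonoid k hT hσ hc α
      have hpz : p • z ∈ F.grading 1 (n • X.coneDeg σ) :=
        X.smul_mem_graded k (F.grading 1) (by simp) hp hzm
      have h0 := (hex0 _).mpr ⟨X.mkSection k (F.grading 1) σ n (p • z) hpz, rfl⟩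
      rw [FreeComplex.sheafDiff, sectionsMap_mkSection, hφ, mkSection_eq_zero_iff] at h0
      obtain ⟨t, ht⟩ := h0
      refine ⟨X.coneMonomial k σ ^ t * p, mul_mem (pow_mem hc _) hpT, ?_⟩
      rw [LinearMap.mem_ker, mul_smul, map_smul]
      exact ht
    · refine X.exists_smul_mem_of_homogeneous (F.grading 0) _ y fun α => ?_
      have hy' : η (decompose (F.grading 0) y α) = 0 := by
        rw [← decompose_map X (F.grading 0) ℳ η (K • X.coneDeg σ) hη, hy]
        simp
      generalize hz : (decompose (F.grading 0) y α : Fin (F.rank 0) → X.Cox k) = z at *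
      have hzm : z ∈ F.grading 0 α := hz ▸ SetLike.coe_mem _
      obtain ⟨n, p, hp, hpT⟩ := X.exists_mem_submonoid k hT hσ hc α
      have hpz : p • z ∈ F.grading 0 (n • X.coneDeg σ) :=
        X.smul_mem_graded k (F.grading 0) (by simp) hp hzm
      obtain ⟨w, hw⟩ := (hex0 (X.mkSection k (F.grading 0) σ n (p • z) hpz)).mp (by
        rw [hφ, mkSection_eq_zero_iff]
        exact ⟨0, by simp [hy']⟩)
      obtain ⟨n', x, hx, rfl⟩ := X.exists_eq_mkSection k _ w
      rw [FreeComplex.sheafDiff, sectionsMap_mkSection, mkSection_eq_iff] at hw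
      obtain ⟨t, ht⟩ := hw
      refine ⟨X.coneMonomial k σ ^ t * (X.coneMonomial k σ ^ n' * p),
        mul_mem (pow_mem hc _) (mul_mem (pow_mem hc _) hpT), ?_⟩
      rw [mul_smul, mul_smul, ← ht]
      exact Submodule.smul_mem _ _ (Submodule.smul_mem _ _ ⟨x, rfl⟩)
  · refine LocalizedModule.exact_map_of_forall T _ _ (fun x => ⟨1, one_mem _, ?_⟩) fun y hy => ?_
    · rw [one_smul]
      exact LinearMap.congr_fun (F.diff_comp_diff i) x
    · exact X.exists_smul_mem_range_of_exact_sections k hT hσ hc (F.grading (i + 2))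
        (F.grading (i + 1)) (F.grading i) (F.diff (i + 1)) (F.diff_deg (i + 1)) (F.diff i)
        (F.diff_deg i) (hex i) hy

variable [Module.Finite (X.Cox k) M]

lemma exists_coneMonomial_notMem {P : Ideal (X.Cox k)} [P.IsPrime] (hP : X.IsRelevant k P) :
    ∃ σ ∈ X.cones, X.coneMonomial k σ ∉ P := by
  by_contra! h
  refine hP 1 le_rfl ?_
  rw [pow_one, irrelevantIdeal, Ideal.span_le]
  rintro _ ⟨σ, hσ, rfl⟩
  exact h σ hσ

/-- The Auslander–Buchsbaum inequality for virtual resolutions. -/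
lemma hasDepthGE_of_isVirtualResolution [IsAlgClosed k] (F : X.FreeComplex k)
    (hF : F.IsVirtualResolution ℳ) {n : ℕ} (hn : F.HasLengthLE n) (P : Ideal (X.Cox k)) [P.IsPrime]
    (hP : X.IsRelevant k P) {r : ℕ} (hr : (r : ℕ∞) ≤ P.height) :
    HasDepthGE (Localization.AtPrime P) (LocalizedModule P.primeCompl M) (r - n) := by
  obtain ⟨σ, hσ, hc⟩ := X.exists_coneMonomial_notMem k hP
  obtain ⟨η, h1, h2, h3⟩ := X.exists_augmentation k ℳ (T := P.primeCompl)
    (fun p q h hp => h (P.mul_mem_right q hp)) hσ hc F hF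
  have : ∀ i, Module.Free (Localization.AtPrime P)
      (LocalizedModule P.primeCompl (Fin (F.rank i) → X.Cox k)) := fun i =>
    Module.free_of_isLocalizedModule P.primeCompl
      (LocalizedModule.mkLinearMap P.primeCompl (Fin (F.rank i) → X.Cox k))
  refine (MvPolynomial.hasDepthGE_atPrime P hr).of_resolution n
    (fun i => LocalizedModule P.primeCompl (Fin (F.rank i) → X.Cox k))
    (fun i => LocalizedModule.map P.primeCompl (F.diff i)) (LocalizedModule.map P.primeCompl η)
    h1 h2 h3 fun i hi => ?_
  have h0 := hn i hi
  have : Subsingleton (Fin (F.rank i) → X.Cox k) := by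
    rw [h0]
    infer_instance
  infer_instance

end SmoothProjectiveFan

/-! ### Codimension bound, and virtually implies geometrically Cohen–Macaulay -/

/-- The minimal primes of the annihilator of `M_P` contract to primes between `Ann M` and `P`, so
that annihilator has height at least `c`; then heights and quotient dimensions are compared in
`A_P`. Bounding only such primes lets `c` be either the codimension or the height of a minimal prime
`P`. -/
lemma Module.supportDim_localizedModule_add_le {A : Type*} [CommRing A] [IsNoetherianRing A]
    (M : Type*) [AddCommGroup M] [Module A M] [Module.Finite A M] (P : Ideal A) [P.IsPrime] (c : ℕ∞)
    (h : ∀ Q : Ideal A, Q.IsPrime → Module.annihilator A M ≤ Q → Q ≤ P → c ≤ Q.height) :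
    Module.supportDim (Localization.AtPrime P) (LocalizedModule P.primeCompl M) + c ≤
      (P.height : WithBot ℕ∞) := by
  let B := Localization.AtPrime P
  set I := Module.annihilator B (LocalizedModule P.primeCompl M) with hI
  have hc : c ≤ I.height := by
    rw [Ideal.height_eq_inf_minimalPrimes]
    refine le_iInf₂ fun J hJ => ?_
    have hJp : J.IsPrime := hJ.1.1
    rw [← IsLocalization.height_under P.primeCompl J]
    refine h _ inferInstance (fun x hx => hJ.1.2 ?_) ?_
    · change algebraMap A B x ∈ I
      rw [hI, Module.mem_annihilator]
      intro m
      induction m using LocalizedModule.induction_on with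
      | h m t =>
        rw [algebraMap_smul, LocalizedModule.smul'_mk, Module.mem_annihilator.mp hx,
          LocalizedModule.zero_mk]
    · exact (Ideal.comap_mono (IsLocalRing.le_maximalIdeal hJp.ne_top)).trans
        (Localization.AtPrime.under_maximalIdeal (I := P)).le
  rw [Module.supportDim_eq_ringKrullDim_quotient_annihilator,
    ← IsLocalization.AtPrime.ringKrullDim_eq_height P B, add_comm]
  refine le_trans ?_ (Ideal.height_add_ringKrullDim_quotient_le I)
  gcongr
  exact_mod_cast hc

namespace SmoothProjectiveFan

variable {d : ℕ} {R : Type*} [Fintype R] [DecidableEq R] (X : SmoothProjectiveFan d R)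
  (k : Type*) [Field k]
  {M : Type*} [AddCommGroup M] [Module (X.Cox k) M] (ℳ : X.Pic → AddSubgroup M)
  [SetLike.GradedSMul (X.coxGrading k) ℳ]

lemma IsRelevant.mono {I J : Ideal (X.Cox k)} (h : X.IsRelevant k J) (hIJ : I ≤ J) :
    X.IsRelevant k I := fun t ht hI => h t ht (hI.trans hIJ)

/-- If `m / c^n` is a nonzero section, with `c = coneMonomial σ`, no power of `c` kills `m`. Hence a
prime contains the annihilator of `m` and avoids `c`. -/
lemma exists_isRelevant_mem_support (h : X.SheafNeZero k ℳ) :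
    ∃ P ∈ Module.support (X.Cox k) M, X.IsRelevant k P.asIdeal := by
  obtain ⟨σ, hσ, hn⟩ := h
  obtain ⟨z, hz⟩ := exists_ne (0 : X.sections k ℳ σ)
  obtain ⟨n, m, hm, rfl⟩ := X.exists_eq_mkSection k ℳ z
  rw [Ne, mkSection_eq_zero_iff] at hz
  push Not at hz
  obtain ⟨P, hP, hle, hdis⟩ := Ideal.exists_le_prime_disjoint
    ((Submodule.span (X.Cox k) {m}).annihilator) (X.coneSub k σ) (by
      rw [Set.disjoint_left]
      rintro x hx ⟨t, rfl⟩
      exact hz t ((Submodule.mem_annihilator_span_singleton _ _).mp hx))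
  refine ⟨⟨P, hP⟩, Module.mem_support_iff_exists_annihilator.mpr ⟨m, hle⟩, fun t _ ht => ?_⟩
  exact Set.disjoint_left.mp hdis (hP.le_of_pow_le ht (Ideal.subset_span ⟨σ, hσ, rfl⟩))
    ⟨1, pow_one _⟩

variable [Module.Finite (X.Cox k) M] [DirectSum.Decomposition ℳ] [IsAlgClosed k]

omit [DirectSum.Decomposition ℳ] [IsAlgClosed k] [SetLike.GradedSMul (X.coxGrading k) ℳ] in
lemma exists_nat_height (P : Ideal (X.Cox k)) (hP : P ≠ ⊤) : ∃ r : ℕ, P.height = r :=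
  ENat.ne_top_iff_exists.mp (Ideal.height_ne_top hP) |>.imp fun _ h => h.symm

/-- At a minimal prime `P` of the annihilator below a relevant prime of the support, `M_P` is
nonzero of dimension zero but has depth at least `ht P - n`, so `codim M ≤ ht P ≤ n`. -/
lemma codim_le_of_isVirtualResolution (h : X.SheafNeZero k ℳ) (F : X.FreeComplex k)
    (hF : F.IsVirtualResolution ℳ) {n : ℕ} (hn : F.HasLengthLE n) : X.codim k M ≤ n := by
  obtain ⟨P₁, hP₁, hrel₁⟩ := X.exists_isRelevant_mem_support k ℳ h
  rw [Module.support_eq_zeroLocus] at hP₁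
  obtain ⟨P, hP, hPle⟩ := Ideal.exists_minimalPrimes_le hP₁
  have hPp : P.IsPrime := hP.1.1
  have hrel := hrel₁.mono X k hPle
  have hsupp : (⟨P, hPp⟩ : PrimeSpectrum (X.Cox k)) ∈ Module.support (X.Cox k) M := by
    rw [Module.support_eq_zeroLocus]
    exact hP.1.2
  have hnt : Nontrivial (LocalizedModule P.primeCompl M) := hsupp
  obtain ⟨r, hr⟩ := X.exists_nat_height k P hPp.ne_top
  have h1 := (X.hasDepthGE_of_isVirtualResolution k ℳ F hF hn P hrel hr.ge).le_supportDim
  have h2 := Module.supportDim_localizedModule_add_le M P r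
    (fun Q hQ hQ1 hQ2 => hr ▸ Ideal.height_mono (hP.2 ⟨hQ, hQ1⟩ hQ2))
  refine (Ideal.height_mono hP.1.2).trans ?_
  rw [hr] at h2 ⊢
  have h3 : (((r - n : ℕ) : ℕ∞) : WithBot ℕ∞) + ((r : ℕ∞) : WithBot ℕ∞) ≤ ((r : ℕ∞) : WithBot ℕ∞) :=
    (by gcongr; exact h1 : _ ≤ _).trans h2
  norm_cast at h3 ⊢
  omega

lemma codim_le_vdim (h : X.SheafNeZero k ℳ) : X.codim k M ≤ X.vdim k ℳ := by
  refine le_sInf ?_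
  rintro _ ⟨F, n, hF, hn, rfl⟩
  exact X.codim_le_of_isVirtualResolution k ℳ h F hF hn

/-- With a virtual resolution of length `c = codim M`, depth `M_P` is at least `ht P - c`, while
`dim M_P ≤ ht P - c` because every prime over the annihilator has height at least `c`. -/
theorem IsVirtuallyCM.isGeometricallyCM (h : X.IsVirtuallyCM k ℳ) : X.IsGeometricallyCM k M := by
  rintro ⟨P, hPp⟩ hP hrel
  have hnt : Nontrivial (LocalizedModule P.primeCompl M) := hP
  rw [Module.support_eq_zeroLocus] at hP
  have hne : Module.annihilator (X.Cox k) M ≠ ⊤ := fun h => hPp.ne_top (top_le_iff.mp (h ▸ hP))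
  obtain ⟨c, hc⟩ := X.exists_nat_height k _ hne
  have hv : X.vdim k ℳ = c := h.2.trans hc
  obtain ⟨F, n, hF, hn, hcn⟩ : X.vdim k ℳ ∈ {l : ℕ∞ | ∃ (F : X.FreeComplex k) (n : ℕ),
      F.IsVirtualResolution ℳ ∧ F.HasLengthLE n ∧ l = n} := by
    -- The infimum is attained unless the set is empty, in which case `vdim` would be infinite.
    refine csInf_mem (Set.nonempty_iff_ne_empty.mpr fun he => ?_)
    rw [vdim, he, sInf_empty] at hv
    exact ENat.top_ne_natCast _ hv
  obtain rfl : c = n := by exact_mod_cast hv.symm.trans hcn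
  obtain ⟨r, hr⟩ := X.exists_nat_height k P hPp.ne_top
  have hd := X.hasDepthGE_of_isVirtualResolution k ℳ F hF hn P hrel hr.ge
  have hle := Module.supportDim_localizedModule_add_le M P c
    (fun Q _ hQ _ => hc ▸ Ideal.height_mono hQ)
  have hcr : c ≤ r := by
    have := Ideal.height_mono hP
    rw [hc, hr] at this
    exact_mod_cast this
  refine Or.inr (le_antisymm ?_ ?_)
  -- The default `0` of `unbotD` is never used, since the support of a nonzero module has dimension
  -- different from `⊥`.
  · have : localDepth (Localization.AtPrime P) (LocalizedModule P.primeCompl M) ≤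
        (Module.supportDim (Localization.AtPrime P) (LocalizedModule P.primeCompl M)).unbotD 0 := by
      refine iSup₂_le fun rs hrs => ?_
      have := HasDepthGE.le_supportDim (A := Localization.AtPrime P)
        (N := LocalizedModule P.primeCompl M) (n := rs.length) (Or.inr ⟨rs, rfl, hrs⟩)
      revert this
      generalize Module.supportDim (Localization.AtPrime P) (LocalizedModule P.primeCompl M) = D
      induction D with
      | bot => intro h; simp at h
      | coe D => intro h; exact_mod_cast h
    have hne := Module.supportDim_ne_bot_of_nontrivial (Localization.AtPrime P)
      (LocalizedModule P.primeCompl M)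
    revert this hne
    generalize Module.supportDim (Localization.AtPrime P) (LocalizedModule P.primeCompl M) = D
    induction D with
    | bot => intro _ h; exact absurd rfl h
    | coe D => intro h _; exact_mod_cast h
  · have h1 : ((r - c : ℕ) : ℕ∞) ≤
        localDepth (Localization.AtPrime P) (LocalizedModule P.primeCompl M) := by
      obtain h | ⟨rs, hl, hrs⟩ := hd
      · exact absurd h (not_subsingleton _)
      · rw [← hl]
        exact le_iSup₂_of_le rs hrs le_rfl
    refine le_trans ?_ (WithBot.coe_le_coe.mpr h1)
    rw [hr] at hle
    revert hle
    generalize Module.supportDim (Localization.AtPrime P) (LocalizedModule P.primeCompl M) = D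
    induction D with
    | bot => intro _; exact bot_le
    | coe D =>
      induction D with
      | top => intro h; norm_cast at h
      | coe D => intro h; norm_cast at h ⊢; omega

end SmoothProjectiveFan

/-! ### Minimal resolutions over a regular local ring -/

/-- As `N` is projective, `g` splits, and the projection of `F` onto `ker g` shows that `ker g` is
contained in the maximal ideal times itself. Nakayama's lemma concludes. -/
lemma LinearMap.ker_eq_bot_of_le_smul_top {A : Type*} [CommRing A] [IsLocalRing A]
    {F N : Type*} [AddCommGroup F] [Module A F] [IsNoetherian A F] [AddCommGroup N] [Module A N]
    [Module.Projective A N] (g : F →ₗ[A] N) (hg : Function.Surjective g)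
    (h : LinearMap.ker g ≤ IsLocalRing.maximalIdeal A • (⊤ : Submodule A F)) :
    LinearMap.ker g = ⊥ := by
  obtain ⟨s, hs⟩ := Module.projective_lifting_property g LinearMap.id hg
  let p : F →ₗ[A] F := LinearMap.id - s ∘ₗ g
  have hgp : ∀ x, g (p x) = 0 := fun x => by
    have := LinearMap.congr_fun hs (g x)
    simp only [LinearMap.comp_apply, LinearMap.id_apply] at this
    simp [p, this]
  refine Submodule.eq_bot_of_le_smul_of_le_jacobson_bot (IsLocalRing.maximalIdeal A) _
    (IsNoetherian.noetherian _) ?_ (IsLocalRing.maximalIdeal_le_jacobson _)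
  calc LinearMap.ker g ≤ (LinearMap.ker g).map p := fun x hx =>
        ⟨x, hx, by simp [p, LinearMap.mem_ker.mp hx]⟩
    _ ≤ (IsLocalRing.maximalIdeal A • (⊤ : Submodule A F)).map p := Submodule.map_mono h
    _ = IsLocalRing.maximalIdeal A • (⊤ : Submodule A F).map p := Submodule.map_smul'' _ _ _
    _ ≤ IsLocalRing.maximalIdeal A • LinearMap.ker g := by
        refine Submodule.smul_mono le_rfl ?_
        rintro _ ⟨x, -, rfl⟩
        exact hgp x

section MinimalResolution

variable {A : Type u} [CommRing A] [IsLocalRing A] [IsNoetherianRing A] {n : ℕ}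
  (hA : HasDepthGE A A n) {N : Type w} [AddCommGroup N] [Module A N] [Module.Finite A N]
  (F : ℕ → Type v) [∀ i, AddCommGroup (F i)] [∀ i, Module A (F i)] [∀ i, Module.Finite A (F i)]
  [∀ i, Module.Free A (F i)] (f : ∀ i, F (i + 1) →ₗ[A] F i) (g : F 0 →ₗ[A] N)
  (hg : Function.Surjective g) (hfg : Function.Exact (f 0) g)
  (hf : ∀ i, Function.Exact (f (i + 1)) (f i))

include hA hg hfg hf

/-- Each syzygy module increases the depth by one. -/
lemma HasDepthGE.range_of_resolution {δ : ℕ} (hN : HasDepthGE A N δ) (i : ℕ) (hi : δ + i + 1 ≤ n) :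
    HasDepthGE A (LinearMap.range (f i)) (δ + i + 1) := by
  induction i with
  | zero =>
    exact HasDepthGE.kernel (LinearMap.range (f 0)).subtype g (Submodule.subtype_injective _) hg
      (fun y => by rw [hfg y]; simp) ((hA.mono hi).free (F 0)) hN
  | succ i ih =>
    exact HasDepthGE.kernel (LinearMap.range (f (i + 1))).subtype (f i).rangeRestrict
      (Submodule.subtype_injective _) (f i).surjective_rangeRestrict
      (fun y => by
        rw [Subtype.ext_iff]
        change f i y = 0 ↔ _
        rw [hf i y]
        simp)
      ((hA.mono hi).free (F (i + 1))) (ih (by omega))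

/-- A minimal free resolution over a regular local ring of dimension `n` of a module of depth `δ`
stops at step `n - δ`. -/
lemma eq_zero_of_minimal_resolution (y : Fin n → A)
    (hy : IsLocalRing.maximalIdeal A = Ideal.span (Set.range y)) {δ : ℕ} (hδ : δ ≤ n)
    (hN : HasDepthGE A N δ)
    (hmin : ∀ i, LinearMap.range (f i) ≤ IsLocalRing.maximalIdeal A • (⊤ : Submodule A (F i))) :
    f (n - δ) = 0 := by
  rw [← LinearMap.range_eq_bot]
  rcases h : n - δ with _ | e
  · obtain rfl : δ = n := by omega
    have := Module.Free.of_hasDepthGE _ y hy hN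
    rw [← hfg.linearMap_ker_eq]
    exact g.ker_eq_bot_of_le_smul_top hg (hfg.linearMap_ker_eq.trans_le (hmin 0))
  -- Here `δ + e + 1 = n`, so the image of `f e` has full depth and is free. The next differential
  -- maps onto the kernel of a surjection to a free module, and minimality makes that kernel zero.
  · have h1 := HasDepthGE.range_of_resolution hA F f g hg hfg hf hN e (by omega)
    rw [show δ + e + 1 = n by omega] at h1
    have := Module.Free.of_hasDepthGE _ y hy h1
    rw [← (hf e).linearMap_ker_eq, ← (f e).ker_rangeRestrict]
    exact (f e).rangeRestrict.ker_eq_bot_of_le_smul_top (f e).surjective_rangeRestrict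
      (((f e).ker_rangeRestrict.trans (hf e).linearMap_ker_eq).trans_le (hmin _))

end MinimalResolution

/-! ### Minimal graded free resolutions -/

namespace SmoothProjectiveFan

variable {d : ℕ} {R : Type*} [Fintype R] [DecidableEq R] (X : SmoothProjectiveFan d R)
  {k : Type*} [Field k]
  {N : Type*} [AddCommGroup N] [Module (X.Cox k) N] (𝒩 : X.Pic → AddSubgroup N)
  [SetLike.GradedSMul (X.coxGrading k) 𝒩] [DirectSum.Decomposition 𝒩]

open DirectSum in
lemma exists_homogeneous_generators (K : Submodule (X.Cox k) N) (hK : K.FG)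
    (hh : ∀ x ∈ K, ∀ α, (decompose 𝒩 x α : N) ∈ K) :
    ∃ (b : ℕ) (a : Fin b → X.Pic) (y : Fin b → N), (∀ j, y j ∈ 𝒩 (a j)) ∧
      Submodule.span (X.Cox k) (Set.range y) = K := by
  classical
  obtain ⟨t, ht⟩ := hK
  let s : Finset (X.Pic × N) := t.biUnion fun x => (decompose 𝒩 x).support.image fun α =>
    (α, (decompose 𝒩 x α : N))
  refine ⟨s.card, fun j => (s.equivFin.symm j).1.1, fun j => (s.equivFin.symm j).1.2,
    fun j => ?_, le_antisymm ?_ ?_⟩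
  · dsimp only
    generalize s.equivFin.symm j = z
    obtain ⟨⟨α, m⟩, hz⟩ := z
    simp only [s, Finset.mem_biUnion, Finset.mem_image, Prod.mk.injEq] at hz
    obtain ⟨x, -, _, -, rfl, rfl⟩ := hz
    exact (decompose 𝒩 x _).2
  · rw [Submodule.span_le]
    rintro _ ⟨j, rfl⟩
    dsimp only
    generalize s.equivFin.symm j = z
    obtain ⟨⟨α, m⟩, hz⟩ := z
    simp only [s, Finset.mem_biUnion, Finset.mem_image, Prod.mk.injEq] at hz
    obtain ⟨x, hx, _, -, rfl, rfl⟩ := hz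
    exact hh x (ht ▸ Submodule.subset_span hx) _
  · rw [← ht, Submodule.span_le]
    intro x hx
    rw [← sum_support_decompose 𝒩 x]
    refine Submodule.sum_mem _ fun α hα => Submodule.subset_span ?_
    have hz : (α, (decompose 𝒩 x α : N)) ∈ s := by
      simp only [s, Finset.mem_biUnion, Finset.mem_image, Prod.mk.injEq]
      exact ⟨x, hx, α, hα, rfl, rfl⟩
    exact ⟨s.equivFin ⟨_, hz⟩, by simp⟩

-- A least number of homogeneous generators is used. If a relation had a nonzero constant term, so
-- would one of its homogeneous components; positivity makes that coefficient a nonzero constant,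
-- and the corresponding generator could be dropped.
open DirectSum in
lemma exists_minimal_cover (K : Submodule (X.Cox k) N) (hK : K.FG)
    (hh : ∀ x ∈ K, ∀ α, (decompose 𝒩 x α : N) ∈ K) :
    ∃ (b : ℕ) (a : Fin b → X.Pic) (f : (Fin b → X.Cox k) →ₗ[X.Cox k] N),
      (∀ α, ∀ x ∈ X.freeGrading k a α, f x ∈ 𝒩 α) ∧ LinearMap.range f = K ∧
      ∀ x, f x = 0 → ∀ j, MvPolynomial.coeff 0 (x j) = 0 := by
  classical
  have hex := X.exists_homogeneous_generators 𝒩 K hK hh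
  obtain ⟨a, y, hy, hspan⟩ := Nat.find_spec hex
  have hmin : ∀ m < Nat.find hex, _ := fun m hm => Nat.find_min hex hm
  generalize Nat.find hex = b at *
  have hdeg : ∀ α, ∀ x ∈ X.freeGrading k a α, Fintype.linearCombination (X.Cox k) y x ∈ 𝒩 α := by
    intro α x hx
    rw [Fintype.linearCombination_apply]
    exact sum_mem fun j _ => X.smul_mem_graded k 𝒩 (by simp) (hx j) (hy j)
  refine ⟨b, a, Fintype.linearCombination (X.Cox k) y, hdeg, ?_, fun x hx j => ?_⟩
  · rw [Fintype.range_linearCombination, hspan]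
  · by_contra hj
    obtain ⟨α, hα⟩ : ∃ α, MvPolynomial.coeff 0
        ((decompose (X.freeGrading k a) x α : Fin b → X.Cox k) j) ≠ 0 := by
      by_contra! h0
      apply hj
      conv_lhs => rw [← sum_support_decompose (X.freeGrading k a) x]
      rw [Finset.sum_apply, MvPolynomial.coeff_sum]
      exact Finset.sum_eq_zero fun α _ => h0 α
    have hfz : Fintype.linearCombination (X.Cox k) y (decompose (X.freeGrading k a) x α) = 0 := by
      rw [← decompose_map X (X.freeGrading k a) 𝒩 _ 0 (by simpa using hdeg), hx]
      simp
    have hzj := X.eq_C_of_coeff_zero_ne_zero ((decompose (X.freeGrading k a) x α).2 j) hα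
    generalize (decompose (X.freeGrading k a) x α : Fin b → X.Cox k) = z at *
    obtain _ | b := b
    · exact j.elim0
    refine hmin b (Nat.lt_succ_self b) ⟨a ∘ j.succAbove, y ∘ j.succAbove, fun i => hy _, ?_⟩
    rw [← hspan]
    refine le_antisymm (Submodule.span_mono (Set.range_comp_subset_range _ _)) ?_
    rw [Submodule.span_le]
    rintro _ ⟨i, rfl⟩
    by_cases hi : i = j
    · subst hi
      rw [Fintype.linearCombination_apply, Fin.sum_univ_succAbove _ i] at hfz
      have h1 : y i = -((MvPolynomial.C (MvPolynomial.coeff 0 (z i))⁻¹ : X.Cox k) •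
          ∑ l, z (i.succAbove l) • y (i.succAbove l)) := by
        rw [← neg_eq_of_add_eq_zero_right hfz, smul_neg, neg_neg, smul_smul, hzj,
          MvPolynomial.coeff_C, if_pos rfl, ← map_mul, inv_mul_cancel₀ hα, map_one, one_smul]
      rw [h1]
      exact Submodule.neg_mem _ (Submodule.smul_mem _ _ (Submodule.sum_mem _ fun l _ =>
        Submodule.smul_mem _ _ (Submodule.subset_span ⟨l, rfl⟩)))
    · obtain ⟨l, rfl⟩ := Fin.exists_succAbove_eq hi
      exact Submodule.subset_span ⟨l, rfl⟩

end SmoothProjectiveFan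

namespace SmoothProjectiveFan

variable {d : ℕ} {R : Type*} [Fintype R] [DecidableEq R] (X : SmoothProjectiveFan d R)
  (k : Type*) [Field k]

/-- A homogeneous submodule of a graded free module of finite rank. -/
structure HomogeneousSyzygy where
  rank : ℕ
  twist : Fin rank → X.Pic
  ker : Submodule (X.Cox k) (Fin rank → X.Cox k)
  decompose_mem : ∀ x ∈ ker, ∀ α,
    (DirectSum.decompose (X.freeGrading k twist) x α : Fin rank → X.Cox k) ∈ ker

section Cover

variable {N : Type*} [AddCommGroup N] [Module (X.Cox k) N] (𝒩 : X.Pic → AddSubgroup N)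
  [SetLike.GradedSMul (X.coxGrading k) 𝒩] [DirectSum.Decomposition 𝒩]

lemma exists_homogeneousSyzygy (K : Submodule (X.Cox k) N) (hK : K.FG)
    (hh : ∀ x ∈ K, ∀ α, (DirectSum.decompose 𝒩 x α : N) ∈ K) :
    ∃ (s : X.HomogeneousSyzygy k) (f : (Fin s.rank → X.Cox k) →ₗ[X.Cox k] N),
      (∀ α, ∀ x ∈ X.freeGrading k s.twist α, f x ∈ 𝒩 α) ∧ LinearMap.range f = K ∧
      LinearMap.ker f = s.ker ∧ ∀ x ∈ s.ker, ∀ j, MvPolynomial.coeff 0 (x j) = 0 := by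
  obtain ⟨b, a, f, hf, hr, hmin⟩ := X.exists_minimal_cover 𝒩 K hK hh
  refine ⟨⟨b, a, LinearMap.ker f, fun x hx α => ?_⟩, f, hf, hr, rfl, hmin⟩
  rw [LinearMap.mem_ker] at *
  rw [← decompose_map X (X.freeGrading k a) 𝒩 f 0 (by simpa using hf), hx]
  simp

end Cover

variable {M : Type*} [AddCommGroup M] [Module (X.Cox k) M] (ℳ : X.Pic → AddSubgroup M)
  [SetLike.GradedSMul (X.coxGrading k) ℳ] [DirectSum.Decomposition ℳ]
  [Module.Finite (X.Cox k) M]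

/-- Minimal covers of the successive kernels are spliced together; each kernel is again homogeneous
and finitely generated, so the recursion runs through `HomogeneousSyzygy`. -/
lemma exists_minimal_freeComplex : ∃ (F : X.FreeComplex k)
    (η : (Fin (F.rank 0) → X.Cox k) →ₗ[X.Cox k] M),
    (∀ α, ∀ x ∈ F.grading 0 α, η x ∈ ℳ α) ∧ Function.Surjective η ∧
    Function.Exact (F.diff 0) η ∧ (∀ i, Function.Exact (F.diff (i + 1)) (F.diff i)) ∧
    ∀ i x j, MvPolynomial.coeff 0 (F.diff i x j) = 0 := by
  obtain ⟨s₀, η, hη, hr, hk, hmin₀⟩ := X.exists_homogeneousSyzygy k ℳ ⊤ Module.Finite.fg_top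
    (fun _ _ _ => Submodule.mem_top)
  choose t f hf hfr hfk hmin using fun s : X.HomogeneousSyzygy k =>
    X.exists_homogeneousSyzygy k (X.freeGrading k s.twist) s.ker (IsNoetherian.noetherian _)
      s.decompose_mem
  let st : ℕ → X.HomogeneousSyzygy k := fun i => Nat.rec s₀ (fun _ s => t s) i
  have hst : ∀ i, ∀ x ∈ (st i).ker, ∀ j, MvPolynomial.coeff 0 (x j) = 0 := by
    rintro (_ | i)
    · exact hmin₀
    · exact hmin (st i)
  have hex : ∀ i, Function.Exact (f (st (i + 1))) (f (st i)) := fun i => by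
    rw [LinearMap.exact_iff]
    exact (hfk (st i)).trans (hfr (t (st i))).symm
  refine ⟨⟨fun i => (st i).rank, fun i => (st i).twist, fun i => f (st i), fun i => hf (st i),
    fun i => (hex i).linearMap_comp_eq_zero⟩, η, hη, LinearMap.range_eq_top.mp hr, ?_, hex,
    fun i x j => hst i _ ?_ j⟩
  · rw [LinearMap.exact_iff]
    exact hk.trans (hfr s₀).symm
  · rw [← hfr (st i)]
    exact ⟨x, rfl⟩

section Sections

variable {A : Type*} [AddCommGroup A] [Module (X.Cox k) A] (𝒜 : X.Pic → AddSubgroup A)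
  [SetLike.GradedSMul (X.coxGrading k) 𝒜] [DirectSum.Decomposition 𝒜]
  {N : Type*} [AddCommGroup N] [Module (X.Cox k) N] (𝒩 : X.Pic → AddSubgroup N)
  [SetLike.GradedSMul (X.coxGrading k) 𝒩] [DirectSum.Decomposition 𝒩]
  {Q : Type*} [AddCommGroup Q] [Module (X.Cox k) Q] (𝒬 : X.Pic → AddSubgroup Q)
  [SetLike.GradedSMul (X.coxGrading k) 𝒬]

lemma surjective_sectionsMap (f : A →ₗ[X.Cox k] N) (hf : ∀ α, ∀ m ∈ 𝒜 α, f m ∈ 𝒩 α)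
    (h : Function.Surjective f) (σ : Finset R) :
    Function.Surjective (X.sectionsMap k 𝒜 𝒩 f hf σ) := by
  intro z
  obtain ⟨n, m, hm, rfl⟩ := X.exists_eq_mkSection k 𝒩 z
  obtain ⟨x, rfl⟩ := h m
  obtain ⟨y, hy, hyx⟩ := X.exists_mem_of_map_mem 𝒜 𝒩 f hf hm
  refine ⟨X.mkSection k 𝒜 σ n y hy, ?_⟩
  rw [sectionsMap_mkSection]
  simp_rw [hyx]

/-- Exactness survives in degree zero because a homogeneous element of the image has a homogeneous
preimage of the same degree. -/
lemma exact_sectionsMap (f : A →ₗ[X.Cox k] N) (hf : ∀ α, ∀ m ∈ 𝒜 α, f m ∈ 𝒩 α)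
    (g : N →ₗ[X.Cox k] Q) (hg : ∀ α, ∀ m ∈ 𝒩 α, g m ∈ 𝒬 α) (h : Function.Exact f g)
    (σ : Finset R) :
    Function.Exact (X.sectionsMap k 𝒜 𝒩 f hf σ) (X.sectionsMap k 𝒩 𝒬 g hg σ) := by
  intro z
  constructor
  · intro hz
    obtain ⟨n, m, hm, rfl⟩ := X.exists_eq_mkSection k 𝒩 z
    rw [sectionsMap_mkSection, mkSection_eq_zero_iff] at hz
    obtain ⟨t, ht⟩ := hz
    rw [← map_smul] at ht
    obtain ⟨x, hx⟩ := (h _).mp ht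
    have hm' : X.coneMonomial k σ ^ t • m ∈ 𝒩 ((t + n) • X.coneDeg σ) :=
      X.smul_mem_graded k 𝒩 (add_smul _ _ _) (X.coneMonomial_pow_mem k σ t) hm
    obtain ⟨y, hy, hyx⟩ := X.exists_mem_of_map_mem 𝒜 𝒩 f hf (hx ▸ hm')
    refine ⟨X.mkSection k 𝒜 σ (t + n) y hy, ?_⟩
    rw [sectionsMap_mkSection, mkSection_eq_iff]
    refine ⟨0, ?_⟩
    rw [hyx, hx, smul_smul (X.coneMonomial k σ ^ n), ← pow_add, add_comm]
  · rintro ⟨w, rfl⟩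
    obtain ⟨n, m, hm, rfl⟩ := X.exists_eq_mkSection k 𝒜 w
    rw [sectionsMap_mkSection, sectionsMap_mkSection, mkSection_eq_zero_iff]
    exact ⟨0, by rw [h.apply_apply_eq_zero, smul_zero]⟩

end Sections

lemma isVirtualResolution_of_exact (F : X.FreeComplex k)
    (η : (Fin (F.rank 0) → X.Cox k) →ₗ[X.Cox k] M) (hη : ∀ α, ∀ x ∈ F.grading 0 α, η x ∈ ℳ α)
    (hs : Function.Surjective η) (h0 : Function.Exact (F.diff 0) η)
    (h : ∀ i, Function.Exact (F.diff (i + 1)) (F.diff i)) : F.IsVirtualResolution ℳ := by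
  refine ⟨⟨fun σ _ => X.sectionsMap k (F.grading 0) ℳ η hη σ, fun σ _ τ _ hτσ z => ?_⟩,
    fun σ _ => ⟨X.surjective_sectionsMap k _ ℳ η hη hs σ, X.exact_sectionsMap k _ _ ℳ _ (F.diff_deg 0) _ hη h0 σ,
      fun i => X.exact_sectionsMap k _ _ _ _ (F.diff_deg (i + 1)) _ (F.diff_deg i) (h i) σ⟩⟩
  obtain ⟨n, m, hm, rfl⟩ := X.exists_eq_mkSection k _ z
  rw [sectionsMap_mkSection]
  ext1
  change LocalizedModule.map _ η (X.locRes k _ hτσ (LocalizedModule.mk m (X.conePow k σ n))) =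
    X.locRes k _ hτσ (LocalizedModule.mk (η m) (X.conePow k σ n))
  rw [locRes_mk, locRes_mk, LocalizedModule.map_mk, map_smul]

/-- The maximal ideal of the Cox ring generated by the variables. -/
noncomputable abbrev originIdeal : Ideal (X.Cox k) := MvPolynomial.vanishingIdeal k {(0 : R → k)}

lemma mem_originIdeal {f : X.Cox k} : f ∈ X.originIdeal k ↔ MvPolynomial.coeff 0 f = 0 := by
  rw [MvPolynomial.mem_vanishingIdeal_singleton_iff, MvPolynomial.aeval_zero,
    MvPolynomial.constantCoeff_eq]
  simp

include ℳ in
lemma eq_zero_of_mk_eq_zero {m : M} {t : (X.originIdeal k).primeCompl}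
    (h : LocalizedModule.mk m t = 0) : m = 0 := by
  obtain ⟨s, hs, hsm⟩ := LocalizedModule.mk_eq_zero_iff_exists.mp h
  exact X.eq_zero_of_smul_eq_zero ℳ (fun h0 => hs ((X.mem_originIdeal k).mpr h0)) hsm

include ℳ in
/-- The Auslander–Buchsbaum bound: a graded module of depth `δ` at the origin has a free resolution
of length `#R - δ`. -/
lemma exists_freeComplex_hasLengthLE {δ : ℕ} (hδ : δ ≤ Fintype.card R)
    (hM : HasDepthGE (Localization.AtPrime (X.originIdeal k))
      (LocalizedModule (X.originIdeal k).primeCompl M) δ) :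
    ∃ F : X.FreeComplex k, F.IsVirtualResolution ℳ ∧ F.HasLengthLE (Fintype.card R - δ) := by
  obtain ⟨F, η, hη, hs, h0, hex, hmin⟩ := X.exists_minimal_freeComplex k ℳ
  refine ⟨F, X.isVirtualResolution_of_exact k ℳ F η hη hs h0 hex, ?_⟩
  let T := (X.originIdeal k).primeCompl
  have : ∀ i, Module.Free (Localization.AtPrime (X.originIdeal k))
      (LocalizedModule T (Fin (F.rank i) → X.Cox k)) := fun i =>
    Module.free_of_isLocalizedModule T
      (LocalizedModule.mkLinearMap T (Fin (F.rank i) → X.Cox k))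
  have hz : LocalizedModule.map T (F.diff (Fintype.card R - δ)) = 0 := by
    refine eq_zero_of_minimal_resolution (MvPolynomial.hasDepthGE_atPoint (0 : R → k))
      (fun i => LocalizedModule T (Fin (F.rank i) → X.Cox k))
      (fun i => LocalizedModule.map T (F.diff i)) (LocalizedModule.map T η)
      (LocalizedModule.map_surjective T η hs) (LocalizedModule.map_exact T _ _ h0)
      (fun i => LocalizedModule.map_exact T _ _ (hex i)) _
      (MvPolynomial.maximalIdeal_atPoint (0 : R → k) (Fintype.equivFin R).symm) hδ hM ?_
    rintro i _ ⟨z, rfl⟩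
    induction z using LocalizedModule.induction_on with
    | h x t =>
      rw [LocalizedModule.map_mk]
      have : F.diff i x = ∑ j, F.diff i x j • Pi.single j (1 : X.Cox k) := by
        conv_lhs => rw [pi_eq_sum_univ' (F.diff i x)]
      rw [this, LocalizedModule.mk_finset_sum]
      refine Submodule.sum_mem _ fun j _ => ?_
      rw [← LocalizedModule.smul'_mk]
      refine (algebraMap_smul (Localization.AtPrime (X.originIdeal k)) (F.diff i x j) _).subst
        (motive := (· ∈ _)) ?_
      refine Submodule.smul_mem_smul ?_ Submodule.mem_top
      exact (IsLocalization.AtPrime.to_map_mem_maximal_iff _ (X.originIdeal k) _).mpr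
        ((X.mem_originIdeal k).mpr (hmin i x j))
  -- Graded modules embed into their localization at the origin, so the differential already
  -- vanishes over `S`.
  have hz' : F.diff (Fintype.card R - δ) = 0 := by
    refine LinearMap.ext fun x => ?_
    refine X.eq_zero_of_mk_eq_zero k (F.grading _) (t := 1) ?_
    rw [← LocalizedModule.map_mk (S := T), hz, LinearMap.zero_apply]
  -- When a differential is zero, exactness makes the next one surjective, yet its entries have no
  -- constant term; so its target has rank zero.
  have key : ∀ i, F.diff i = 0 → F.rank (i + 1) = 0 := by
    intro i hi
    by_contra hr
    let j : Fin (F.rank (i + 1)) := ⟨0, Nat.pos_of_ne_zero hr⟩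
    obtain ⟨y, hy⟩ := (hex i (Pi.single j 1)).mp (by rw [hi, LinearMap.zero_apply])
    have := hmin (i + 1) y j
    rw [hy] at this
    simp at this
  intro i hi
  obtain ⟨l, rfl⟩ := Nat.exists_eq_add_of_lt hi
  clear hi
  induction l with
  | zero => exact key _ hz'
  | succ l ih =>
    refine key _ ?_
    have : IsEmpty (Fin (F.rank (Fintype.card R - δ + l + 1))) := by
      rw [ih]
      infer_instance
    exact LinearMap.ext fun x => Subsingleton.elim _ _

end SmoothProjectiveFan

/-! ### Arithmetically implies virtually Cohen–Macaulay -/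

lemma hasDepthGE_of_le_localDepth {A : Type*} [CommRing A] [IsLocalRing A] [IsNoetherianRing A]
    {N : Type*} [AddCommGroup N] [Module A N] [Module.Finite A N] {n : ℕ}
    (h : (n : ℕ∞) ≤ localDepth A N) : HasDepthGE A N n := by
  obtain _ | n := n
  · exact HasDepthGE.zero N
  · have h' : (n : ℕ∞) < localDepth A N := lt_of_lt_of_le (by exact_mod_cast n.lt_succ_self) h
    simp only [localDepth, lt_iSup_iff] at h'
    obtain ⟨rs, hrs, hlt⟩ := h'
    exact HasDepthGE.mono (Or.inr ⟨rs, rfl, hrs⟩) (by exact_mod_cast hlt)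

namespace SmoothProjectiveFan

variable {d : ℕ} {R : Type*} [Fintype R] [DecidableEq R] (X : SmoothProjectiveFan d R)
  (k : Type*) [Field k]
  {M : Type*} [AddCommGroup M] [Module (X.Cox k) M] (ℳ : X.Pic → AddSubgroup M)
  [SetLike.GradedSMul (X.coxGrading k) ℳ] [DirectSum.Decomposition ℳ]
  [Module.Finite (X.Cox k) M]

include ℳ in
/-- The codimension formula at the origin. -/
lemma card_le_codim_add_supportDim [Nontrivial M] :
    (Fintype.card R : WithBot ℕ∞) ≤ X.codim k M +
      Module.supportDim (Localization.AtPrime (X.originIdeal k))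
        (LocalizedModule (X.originIdeal k).primeCompl M) := by
  have hne : Module.annihilator (X.Cox k) M ≠ ⊤ := fun h =>
    not_subsingleton M (Module.annihilator_eq_top_iff.mp h)
  obtain ⟨c, hc⟩ := X.exists_nat_height k _ hne
  -- A prime realizing the codimension is replaced by a minimal prime below it, whose height is no
  -- larger.
  obtain ⟨P₁, hP₁, hle₁, hht⟩ := Ideal.exists_isPrime_height_eq hc
  obtain ⟨P, hP, hPle⟩ := Ideal.exists_minimalPrimes_le hle₁
  have hPp : P.IsPrime := hP.1.1
  -- A minimal prime of the annihilator is associated, so its elements are zero divisors on `M`;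
  -- polynomials with nonzero constant term are not.
  have hPm : P ≤ X.originIdeal k := by
    have hass := Module.associatedPrimes.minimalPrimes_annihilator_subset_associatedPrimes
      (X.Cox k) M hP
    intro f hf
    obtain ⟨x, hx, hfx⟩ := (biUnion_associatedPrimes_eq_zero_divisors (X.Cox k) M).subset
      (Set.mem_biUnion hass hf)
    rw [mem_originIdeal]
    by_contra hf0
    exact hx (X.eq_zero_of_smul_eq_zero ℳ hf0 hfx)
  refine (MvPolynomial.card_le_height_add_ringKrullDim (0 : R → k) P hPm).trans ?_
  have h1 : P.height ≤ X.codim k M := (Ideal.height_mono hPle).trans (hht.trans hc.symm).le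
  rw [Module.supportDim_eq_ringKrullDim_quotient_annihilator]
  refine add_le_add (WithBot.coe_le_coe.mpr h1) (ringKrullDim_le_of_surjective
    (Ideal.Quotient.factor ?_) (Ideal.Quotient.factor_surjective ?_))
  -- An element annihilating the localization has a numerator annihilating `M` itself, since `M`
  -- embeds; so it lies in the extension of `P`.
  all_goals
    intro y hy
    obtain ⟨a, s, rfl⟩ := IsLocalization.exists_mk'_eq (X.originIdeal k).primeCompl y
    rw [IsLocalization.mk'_mem_iff]
    refine Ideal.mem_map_of_mem _ (hP.1.2 (Module.mem_annihilator.mpr fun m => ?_))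
    have h2 := Module.mem_annihilator.mp (Ideal.mul_mem_right (algebraMap _ _ s.1) _ hy)
      (LocalizedModule.mk m 1)
    rw [IsLocalization.mk'_spec, algebraMap_smul, LocalizedModule.smul'_mk] at h2
    exact X.eq_zero_of_mk_eq_zero k ℳ h2

/-- Let `δ` be the common value of depth and dimension of `M` at the origin. Depth `δ` gives a
resolution of length `#R - δ`, and dimension `δ` gives `#R - δ ≤ codim M`. -/
theorem IsArithmeticallyCM.vdim_le_codim [Nontrivial M] (h : X.IsArithmeticallyCM k M) :
    X.vdim k ℳ ≤ X.codim k M := by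
  have hinj : ∀ m : M, (LocalizedModule.mk m 1 :
      LocalizedModule (X.originIdeal k).primeCompl M) = 0 → m = 0 :=
    fun m => X.eq_zero_of_mk_eq_zero k ℳ
  have hnt : Nontrivial (LocalizedModule (X.originIdeal k).primeCompl M) := by
    obtain ⟨m, hm⟩ := exists_ne (0 : M)
    exact nontrivial_of_ne _ _ fun h0 => hm (hinj m h0)
  have hcm : (localDepth (Localization.AtPrime (X.originIdeal k))
      (LocalizedModule (X.originIdeal k).primeCompl M) : WithBot ℕ∞) =
      Module.supportDim (Localization.AtPrime (X.originIdeal k))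
        (LocalizedModule (X.originIdeal k).primeCompl M) :=
    (h ⟨X.originIdeal k, inferInstance⟩ hnt).resolve_left (not_subsingleton _)
  have hle := (Module.supportDim_le_ringKrullDim (Localization.AtPrime (X.originIdeal k))
    (LocalizedModule (X.originIdeal k).primeCompl M)).trans
      (MvPolynomial.ringKrullDim_atPoint_le (0 : R → k))
  have hcodim := X.card_le_codim_add_supportDim k ℳ
  rw [← hcm] at hle hcodim
  obtain ⟨δ, hδ⟩ := ENat.ne_top_iff_exists.mp
    (ne_top_of_le_ne_top (ENat.natCast_ne_top (Fintype.card R)) (WithBot.coe_le_coe.mp hle))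
  obtain ⟨F, hF, hlen⟩ := X.exists_freeComplex_hasLengthLE k ℳ (δ := δ)
    (by rw [← hδ] at hle; exact_mod_cast hle) (hasDepthGE_of_le_localDepth hδ.le)
  have hv : X.vdim k ℳ ≤ (Fintype.card R - δ : ℕ) := sInf_le ⟨F, _, hF, hlen, rfl⟩
  refine hv.trans ?_
  rw [← hδ] at hcodim
  have : (Fintype.card R : ℕ∞) ≤ X.codim k M + δ := by exact_mod_cast hcodim
  rw [ENat.natCast_sub, tsub_le_iff_right]
  exact this

end SmoothProjectiveFan

theorem mainTheorem7 {k : Type*} [Field k] [IsAlgClosed k] {d : ℕ} {R : Type*} [Fintype R]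
    [DecidableEq R] (X : SmoothProjectiveFan d R)
    {M : Type*} [AddCommGroup M] [Module (X.Cox k) M] [Module.Finite (X.Cox k) M]
    (ℳ : X.Pic → AddSubgroup M) [DirectSum.Decomposition ℳ]
    [SetLike.GradedSMul (X.coxGrading k) ℳ] :
    (X.IsArithmeticallyCM k M → X.SheafNeZero k ℳ → X.IsVirtuallyCM k ℳ) ∧
      (X.IsVirtuallyCM k ℳ → X.IsGeometricallyCM k M) := by
  refine ⟨fun h hM => ⟨hM, ?_⟩, fun h => h.isGeometricallyCM X k ℳ⟩
  have hnt : Nontrivial M := by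
    obtain ⟨P, hP, -⟩ := X.exists_isRelevant_mem_support k ℳ hM
    by_contra hM
    rw [not_nontrivial_iff_subsingleton] at hM
    rw [Module.support_eq_empty] at hP
    exact hP
  exact le_antisymm (h.vdim_le_codim X k ℳ) (X.codim_le_vdim k ℳ hM)
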